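/- **Setting.** Multiplicities (also used as kinds) are $m,n,k\in\{\mathbf{lin},\mathbf{un}\}$, ordered by $\mathbf{un}\le\mathbf{lin}$ (and reflexively). Labels $\ell$ are drawn from a denumerable set containing a distinguished label $\mathsf{EOS}$; $L$ ranges over finite non-empty sets of labels. Names $z$ are variables or channel ends; terms are identified up to renaming of bound names and substitution is capture avoiding. Typing environments are finite sequences of distinct bindings $z:A$; names bound by a rule are fresh. **The source calculus LSST.** Types $A,B::=S\mid\mathsf{Unit}\mid A\to_m B\mid A\times B$; session types $S,R::={!}A.S\mid{?}A.S\mid\oplus\{\ell:S_\ell\}_{\ell\in L}\mid\&\{\ell:S_\ell\}_{\ell\in L}\mid\mathsf{end}_!\mid\mathsf{end}_?$. Duality $\overline S$ exchanges $!/?$, $\oplus/\&$ and $\mathsf{end}_!/\mathsf{end}_?$, leaving payloads unchanged. Expressions $M,N::=z\mid()\mid\lambda_m x.M\mid M\,N\mid\langle M,N\rangle\mid\mathbf{let}\ x,y=M\ \mathbf{in}\ N\mid\mathbf{fork}\,M\mid\mathbf{new}\mid\mathbf{send}\,M\mid\mathbf{recv}\,M\mid\mathbf{select}\,\ell\mid\mathbf{rcase}\,M\,\mathbf{of}\,\{\ell:x_\ell.N_\ell\}_{\ell\in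 L}\mid\mathbf{close}\,M\mid\mathbf{wait}\,M$; processes $P,Q::=\langle M\rangle\mid P\mid Q\mid(\nu cd)P$. *Kinding:* $\mathsf{Unit}:\mathbf{un}$; $A\to_mB:m$; $A\times B:m$ if $A:m$ and $B:m$; $S:\mathbf{lin}$; kinds may be raised along $\le$. *Subtyping* is structural: reflexive on $\mathsf{Unit},\mathsf{end}_!,\mathsf{end}_?$; $A\to_mB\le A'\to_nB'$ if $A'\le A$, $B\le B'$, $m\le n$; products covariant; ${!}A.S\le{!}A'.S'$ if $A'\le A$, $S\le S'$; ${?}A.S\le{?}A'.S'$ if $A\le A'$, $S\le S'$; $\oplus\{\ell:S_\ell\}_L\le\oplus\{\ell:S'_\ell\}_{L'}$ if $L'\subseteq L$ and $S_\ell\le S'_\ell$ for $\ell\in L'$; $\&\{\ell:S_\ell\}_L\le\&\{\ell:S'_\ell\}_{L'}$ if $L\subseteq L'$ and $S_\ell\le S'_\ell$ for $\ell\in L$. *Environments:* $\vdash_m\Gamma$ means every binding has kind $m$. The split $\Gamma=\Gamma_1\circ\Gamma_2$ sends each binding $z:A$ either to both parts (if $A:\mathbf{un}$) or to exactly one of them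 (if $A:\mathbf{lin}$), preserving order. *Typing* $\Gamma\vdash_{\rm LSST}M:A$ ($\Gamma=\Gamma_1\circ\Gamma_2$ in rules with two kinds of premises): - $\Gamma_1,z:A,\Gamma_2\vdash z:A$ if $\vdash_{\mathbf{un}}\Gamma_1,\Gamma_2$; subsumption along $\le$; $\Gamma\vdash():\mathsf{Unit}$ if $\vdash_{\mathbf{un}}\Gamma$; - $\Gamma\vdash\lambda_mx.M:A\to_mB$ if $\vdash_m\Gamma$ and $\Gamma,x:A\vdash M:B$; $\Gamma\vdash M\,N:B$ if $\Gamma_1\vdash M:A\to_mB$, $\Gamma_2\vdash N:A$; - $\Gamma\vdash\langle M,N\rangle:A\times B$ if $\Gamma_1\vdash M:A$, $\Gamma_2\vdash N:B$; $\Gamma\vdash\mathbf{let}\,x,y=M\,\mathbf{in}\,N:C$ if $\Gamma_1\vdash M:A\times B$ and $\Gamma_2,x:A,y:B\vdash N:C$; - $\Gamma\vdash\mathbf{fork}\,M:\mathsf{Unit}$ if $\Gamma\vdash M:\mathsf{Unit}$; $\Gamma\vdash\mathbf{new}:S\times\overline S$ if $\vdash_{\mathbf{un}}\Gamma$; $\Gamma\vdash\mathbf{send}\,M:A\to_{\mathbf{lin}}S$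 if $\Gamma\vdash M:{!}A.S$; $\Gamma\vdash\mathbf{recv}\,M:A\times S$ if $\Gamma\vdash M:{?}A.S$; - $\Gamma\vdash\mathbf{select}\,\ell:\oplus\{k:S_k\}_L\to_{\mathbf{lin}}S_\ell$ if $\vdash_{\mathbf{un}}\Gamma$, $\ell\in L$; $\Gamma\vdash\mathbf{rcase}\,M\,\mathbf{of}\,\{\ell:x_\ell.N_\ell\}_L:A$ if $\Gamma_1\vdash M:\&\{\ell:S_\ell\}_L$ and $\Gamma_2,x_\ell:S_\ell\vdash N_\ell:A$ for all $\ell\in L$; - $\Gamma\vdash\mathbf{close}\,M:\mathsf{Unit}$ if $\Gamma\vdash M:\mathsf{end}_!$; $\Gamma\vdash\mathbf{wait}\,M:\mathsf{Unit}$ if $\Gamma\vdash M:\mathsf{end}_?$. *Processes:* $\Gamma\vdash_{\rm LSST}\langle M\rangle$ if $\Gamma\vdash M:\mathsf{Unit}$; $\Gamma_1\circ\Gamma_2\vdash P\mid Q$ if $\Gamma_1\vdash P$, $\Gamma_2\vdash Q$; $\Gamma\vdash(\nu cd)P$ if $\Gamma,c:S,d:\overline S\vdash P$. **The target calculus LDGV.**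 Types $$A,B::=\mathsf{Unit}\mid\mathsf{End}\mid L\mid V=_LW\mid\mathbf{case}\,V\,\mathbf{of}\{\ell:A_\ell\}_{\ell\in L}\mid\Pi_m(x{:}A)B\mid\Sigma(x{:}A)B\mid{!}(x{:}A)S\mid{?}(x{:}A)S,$$ session types $S::=\mathsf{End}\mid\mathbf{case}\,V\,\mathbf{of}\{\ell:S_\ell\}\mid{!}(x{:}A)S\mid{?}(x{:}A)S$, with duality exchanging ${!}(x{:}A)S$ and ${?}(x{:}A)\overline S$ and acting on the branches of $\mathbf{case}$. Values $V,W::=z\mid\ell\mid()\mid\lambda_m(x{:}A).M\mid\langle x{:}A=V,W\rangle\mid\mathbf{send}\,V$; expressions $M,N::=V\mid\mathbf{case}\,V\,\mathbf{of}\{\ell:N_\ell\}\mid M\,N\mid\langle x{:}A=V,N\rangle\mid\mathbf{let}\,x,y=M\,\mathbf{in}\,N\mid\mathbf{new}\mid\mathbf{fork}\,M\mid\mathbf{send}\,M\mid\mathbf{recv}\,M$; processes as for LSST. All the following judgements are defined by simultaneous induction. *Environments.* The unrestricted part: $\mathrm{un}(\cdot)=\cdot$, $\mathrm{un}(\Gamma,z{:}A)=\langle\mathrm{un}\,\Gamma,z{:}A\rangle$.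 Conditional extension: $\langle\Gamma,z{:}A\rangle=\Gamma,z{:}A$ if $\mathrm{un}\,\Gamma\vdash A:\mathbf{un}$, and $\langle\Gamma,z{:}A\rangle=\Gamma$ if $\mathrm{un}\,\Gamma\vdash A:\mathbf{lin}$. Formation: $\vdash_m\cdot$; $\vdash_m\Gamma,z{:}A$ if $\vdash_m\Gamma$ and $\mathrm{un}\,\Gamma\vdash A:m$. Split $\Gamma=\Gamma_1\circ\Gamma_2$: a binding $z{:}A$ goes to both parts if $A$ has kind $\mathbf{un}$ in both unrestricted parts $\mathrm{un}\,\Gamma_i$ of the preceding splits, or to one part $i$ only if $\mathrm{un}\,\Gamma_i\vdash A:\mathbf{lin}$. *Type formation* $\Gamma\vdash A:m$. $\mathsf{Unit}$, $\mathsf{End}$, $L$ have kind $\mathbf{un}$ if $\vdash_{\mathbf{un}}\Gamma$; $V=_LW:\mathbf{un}$ if $\Gamma\vdash V:L$, $\Gamma\vdash W:L$; $\mathbf{case}\,V\,\mathbf{of}\{\ell:A_\ell\}_L:m$ if $\Gamma\vdash V:L$ and $\Gamma,z{:}(V=_L\ell)\vdash A_\ell:m$ for all $\ell\in L$. If $\Gamma\vdash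 A:n$ and $\langle\Gamma,x{:}A\rangle\vdash B:k$, then $\Pi_m(x{:}A)B:m$; if moreover $n=k$, $\Sigma(x{:}A)B:n$; and if $B=S$ is a session type, ${!}(x{:}A)S:\mathbf{lin}$ and ${?}(x{:}A)S:\mathbf{lin}$. Kinds may be raised along $\le$. *Conversion* $\Gamma\vdash A\equiv B:m$ is the least equivalence on types of kind $m$ with: $A[V/x]\equiv A[W/x]:m$ if $\Gamma,x{:}L\vdash A:m$ and $\Gamma\vdash U:(V=_LW)$ for a value $U$; $\mathbf{case}\,\ell\,\mathbf{of}\{k:A_k\}_L\equiv A_\ell:m$ if $\ell\in L$ and $\Gamma\vdash A_k:m$ for all $k\in L$; $A\equiv\mathbf{case}\,V\,\mathbf{of}\{\ell:A\}_L:m$ if $\Gamma\vdash V:L$, $\Gamma\vdash A:m$. *Subtyping* $\Gamma\vdash A\le B:m$ contains conversion, is transitive, kinds may be raised, and: $L\le L':\mathbf{un}$ if $L\subseteq L'$ and $\vdash_{\mathbf{un}}\Gamma$; $\Pi_m(x{:}A)B\le\Pi_{m'}(x{:}A')B':m'$ if $A'\le A:n$, $\langle\Gamma,x{:}A'\rangle\vdash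 B\le B':k$, $m\le m'$; $\Sigma(x{:}A)B\le\Sigma(x{:}A')B':m$ if $A\le A':m$, $\langle\Gamma,x{:}A\rangle\vdash B\le B':m$; ${!}(x{:}A)S\le{!}(x{:}A')S':\mathbf{lin}$ if $A'\le A:m$, $\langle\Gamma,x{:}A'\rangle\vdash S\le S':n$; ${?}(x{:}A)S\le{?}(x{:}A')S':\mathbf{lin}$ if $A\le A':m$, $\langle\Gamma,x{:}A\rangle\vdash S\le S':n$; and $\mathbf{case}\,V\,\mathbf{of}\{\ell:A_\ell\}_L\le\mathbf{case}\,V\,\mathbf{of}\{\ell:A'_\ell\}_{L'}:m$ if $\Gamma\vdash V:L\cap L'$ and $\Gamma,z{:}(V=_{L\cap L'}\ell)\vdash A_\ell\le A'_\ell:m$ for all $\ell\in L\cap L'$. *Typing* $\Gamma\vdash M:A$ ($\Gamma=\Gamma_1\circ\Gamma_2$ where both occur; $S$ a session type): - subsumption: $\Gamma\vdash M:B$ if $\Gamma\vdash M:A$ and $\mathrm{un}\,\Gamma\vdash A\le B:m$; - $\Gamma_1,z{:}A,\Gamma_2\vdash z:A$ if $\vdash_{\mathbf{un}}\langle\Gamma_1,z{:}A\rangle,\Gamma_2$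 (here $\Gamma_1,\Gamma_2$ are the bindings before and after $z$); $():\mathsf{Unit}$ if $\vdash_{\mathbf{un}}\Gamma$; $\ell:L$ if $\ell\in L$ and $\Gamma\vdash L:\mathbf{un}$; - $\mathbf{case}\,V\,\mathbf{of}\{\ell:N_\ell\}_L:B$ if $\mathrm{un}\,\Gamma\vdash V:L$ and $\Gamma,z{:}(V=_L\ell)\vdash N_\ell:B$ for all $\ell\in L$; - $\lambda_m(x{:}A).M:\Pi_m(x{:}A)B$ if $\vdash_m\Gamma$ and $\Gamma,x{:}A\vdash M:B$; $M\,N:B[N/x]$ if $\Gamma_1\vdash M:\Pi_m(x{:}A)B$, $\Gamma_2\vdash N:A$ and $\mathrm{un}\,\Gamma\vdash B[N/x]:n$; - $\langle x{:}A=V,N\rangle:\Sigma(x{:}A)B$ if $\mathrm{un}\,\Gamma\vdash\Sigma(x{:}A)B:m$, $\Gamma_1\vdash V:A$ and $\langle\Gamma_2,x{:}A\rangle\vdash N:B$; for $A=L$ it also suffices, instead of the last premise, that $\Gamma_2,x{:}L,z{:}(x=_LV)\vdash N:B$; - $\mathbf{let}\,x,y=M\,\mathbf{in}\,N:C$ if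 $\Gamma_1\vdash M:\Sigma(x{:}A)B$, $\Gamma_2,x{:}A,y{:}B\vdash N:C$ and $\mathrm{un}\,\Gamma\vdash C:m$; if $A=L$ and $\mathrm{un}\,\Gamma,x{:}L\vdash B:n$, the body premise may be replaced by $\Gamma_2,x{:}L,y{:}B\vdash\mathbf{case}\,x\,\mathbf{of}\{\ell:N\}_L:C$; - $\mathbf{fork}\,M:\mathsf{Unit}$ if $\Gamma\vdash M:\mathsf{Unit}$; $\mathbf{new}:\Sigma(x{:}S)\overline S$ ($x\notin\overline S$) if $\Gamma\vdash S:m$; $\mathbf{send}\,M:\Pi_{\mathbf{lin}}(x{:}A)S$ if $\Gamma\vdash M:{!}(x{:}A)S$; $\mathbf{recv}\,M:\Sigma(x{:}A)S$ if $\Gamma\vdash M:{?}(x{:}A)S$. *Processes:* $\Gamma\vdash\langle M\rangle$ if $\Gamma\vdash M:\mathsf{Unit}$; $\Gamma_1\circ\Gamma_2\vdash P\mid Q$ if $\Gamma_1\vdash P$, $\Gamma_2\vdash Q$; $\Gamma\vdash(\nu cd)P$ if $\mathrm{un}\,\Gamma\vdash S:m$ and $\Gamma,c{:}S,d{:}\overline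 S\vdash P$ for some session type $S$. **The translation.** On types: $[\![\mathsf{Unit}]\!]=\mathsf{Unit}$, $[\![A\to_mB]\!]=\Pi_m(x{:}[\![A]\!])[\![B]\!]$, $[\![A\times B]\!]=\Sigma(x{:}[\![A]\!])[\![B]\!]$, $[\![{!}A.S]\!]={!}(x{:}[\![A]\!])[\![S]\!]$, $[\![{?}A.S]\!]={?}(x{:}[\![A]\!])[\![S]\!]$, $[\![\oplus\{\ell:S_\ell\}_L]\!]={!}(x{:}L)\,\mathbf{case}\,x\,\mathbf{of}\{\ell:[\![S_\ell]\!]\}_L$, $[\![\&\{\ell:S_\ell\}_L]\!]={?}(x{:}L)\,\mathbf{case}\,x\,\mathbf{of}\{\ell:[\![S_\ell]\!]\}_L$, $[\![\mathsf{end}_!]\!]={!}(x{:}\{\mathsf{EOS}\})\mathsf{End}$, $[\![\mathsf{end}_?]\!]={?}(x{:}\{\mathsf{EOS}\})\mathsf{End}$; environments are translated pointwise. On typing derivations (the term $[\![\Gamma\vdash M:A]\!]$, written $[\![M]\!]$, is obtained by recursion on a derivation of $\Gamma\vdash_{\rm LSST}M:A$, whose types supply the annotations): - subsumption steps are ignored;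 $z$, $()$, $\mathbf{new}$ are kept; application, $\mathbf{let}$, $\mathbf{fork}$, $\mathbf{send}$, $\mathbf{recv}$ are translated homomorphically; $[\![\lambda_mx.M]\!]=\lambda_m(x{:}[\![A]\!]).[\![M]\!]$ for $\lambda_mx.M:A\to_mB$; - for $\langle M,N\rangle:A\times B$: $\langle x{:}[\![A]\!]=[\![M]\!],[\![N]\!]\rangle$ if $[\![M]\!]$ is a value, and $(\lambda_{\mathbf{lin}}(x{:}[\![A]\!]).\langle y{:}[\![A]\!]=x,[\![N]\!]\rangle)\,[\![M]\!]$ otherwise; - $[\![\mathbf{select}\,\ell]\!]=\lambda_{\mathbf{lin}}(x{:}[\![\oplus\{k:S_k\}_L]\!]).\,\mathbf{send}\,x\,\ell$; - $[\![\mathbf{rcase}\,M\,\mathbf{of}\{\ell:y.N_\ell\}_L]\!]=\mathbf{let}\,x,y=\mathbf{recv}\,[\![M]\!]\ \mathbf{in}\ \mathbf{case}\,x\,\mathbf{of}\{\ell:[\![N_\ell]\!]\}_L$; - $[\![\mathbf{close}\,M]\!]=(\lambda_{\mathbf{lin}}(y{:}\mathsf{End}).())\,(\mathbf{send}\,[\![M]\!]\,\mathsf{EOS})$;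 $[\![\mathbf{wait}\,M]\!]=\mathbf{let}\,x,y=\mathbf{recv}\,[\![M]\!]\ \mathbf{in}\ ()$. Processes are translated homomorphically. **Theorem (Typing preservation).** For every LSST environment $\Gamma$: 1. for every expression $M$, type $A$ and derivation of $\Gamma\vdash_{\rm LSST}M:A$, $\ \vdash_{\mathbf{lin}}[\![\Gamma]\!]$ and $[\![\Gamma]\!]\vdash[\![\Gamma\vdash M:A]\!]:[\![A]\!]$ in LDGV; 2. for every process $P$ and derivation of $\Gamma\vdash_{\rm LSST}P$, $\ [\![\Gamma]\!]\vdash[\![\Gamma\vdash P]\!]$ in LDGV. -/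

import Mathlib

/-! # Two session-typed calculi and a translation between them

`LSST` is a linear functional calculus with synchronous binary session types,
`LDGV` is a calculus with label-dependent session types.

Binding is represented with de Bruijn indices; variables and channel ends are both names and share
one index space (the most recently bound name has index `0`).
A typing environment is a list of slots, innermost binding first.
A slot `some A` is a binding of type `A`; a slot `none` is a name that is not in the domain of the
environment (for instance because its linear binding went to the other part of a split), kept
so that the remaining indices do not change. In `LDGV` the type in a slot lives in the environment
formed by the slots after it. -/

/-- Multiplicities, which are also the kinds. -/
inductive Mult : Type
  | lin
  | un

/-- Subkinding: unrestricted values may be used linearly. -/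
inductive Mult.Le : Mult → Mult → Prop
  | un_lin : Mult.Le .un .lin
  | lin_lin : Mult.Le .lin .lin
  | un_un : Mult.Le .un .un

/-- The denumerable universe of labels. -/
abbrev Label : Type := ℕ

/-- Finite non-empty sets of labels. -/
abbrev LabelSet : Type := {L : Finset Label // L.Nonempty}

/-- The labels that belong to `L`, the index type of label-indexed families. -/
abbrev LabelSet.Mem (L : LabelSet) : Type := {l : Label // l ∈ L.1}

/-- The distinguished end-of-session label. -/
def eos : Label := 0

/-- The label set `{EOS}`. -/
def eosSet : LabelSet := ⟨{eos}, Finset.singleton_nonempty eos⟩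

/-! ## The source calculus -/

namespace LSST

mutual
  /-- Types `A, B ::= S | Unit | A →ₘ B | A × B`. -/
  inductive Ty : Type
    | ses (S : Ses)
    | unit
    | arr (m : Mult) (A B : Ty)
    | prod (A B : Ty)

  /-- Session types `S, R ::= !A.S | ?A.S | ⊕{l : S_l} | &{l : S_l} | end! | end?`. -/
  inductive Ses : Type
    | send (A : Ty) (S : Ses)
    | recv (A : Ty) (S : Ses)
    | choice (L : LabelSet) (S : L.Mem → Ses)
    | branch (L : LabelSet) (S : L.Mem → Ses)
    | endS
    | endR
end

/-- Session type duality. -/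
def Ses.dual : Ses → Ses
  | .send A S => .recv A S.dual
  | .recv A S => .send A S.dual
  | .choice L S => .branch L (fun l => (S l).dual)
  | .branch L S => .choice L (fun l => (S l).dual)
  | .endS => .endR
  | .endR => .endS

/-- Kinding. -/
inductive HasKind : Mult → Ty → Prop
  | unit : HasKind .un .unit
  | arr (m : Mult) (A B : Ty) : HasKind m (.arr m A B)
  | prod {m : Mult} {A B : Ty} : HasKind m A → HasKind m B → HasKind m (.prod A B)
  | ses (S : Ses) : HasKind .lin (.ses S)
  | sub {m n : Mult} {A : Ty} : HasKind m A → m.Le n → HasKind n A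

/-- Subtyping. -/
inductive Sub : Ty → Ty → Prop
  | unit : Sub .unit .unit
  | endS : Sub (.ses .endS) (.ses .endS)
  | endR : Sub (.ses .endR) (.ses .endR)
  | arr {A A' B B' : Ty} {m n : Mult} :
      Sub A' A → Sub B B' → m.Le n → Sub (.arr m A B) (.arr n A' B')
  | prod {A A' B B' : Ty} : Sub A A' → Sub B B' → Sub (.prod A B) (.prod A' B')
  | send {A A' : Ty} {S S' : Ses} :
      Sub A' A → Sub (.ses S) (.ses S') → Sub (.ses (.send A S)) (.ses (.send A' S'))
  | recv {A A' : Ty} {S S' : Ses} :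
      Sub A A' → Sub (.ses S) (.ses S') → Sub (.ses (.recv A S)) (.ses (.recv A' S'))
  | choice {L L' : LabelSet} {S : L.Mem → Ses} {S' : L'.Mem → Ses} (hL : L'.1 ⊆ L.1) :
      (∀ l : L'.Mem, Sub (.ses (S ⟨l.1, hL l.2⟩)) (.ses (S' l))) →
      Sub (.ses (.choice L S)) (.ses (.choice L' S'))
  | branch {L L' : LabelSet} {S : L.Mem → Ses} {S' : L'.Mem → Ses} (hL : L.1 ⊆ L'.1) :
      (∀ l : L.Mem, Sub (.ses (S l)) (.ses (S' ⟨l.1, hL l.2⟩))) →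
      Sub (.ses (.branch L S)) (.ses (.branch L' S'))

/-- Expressions. `lam` binds one name; `letp M N` is `let x, y = M in N`, where in `N` the name `y`
has index `0` and `x` has index `1`; each branch of `rcase` binds one name. -/
inductive Tm : Type
  | name (i : ℕ)
  | unit
  | lam (m : Mult) (M : Tm)
  | app (M N : Tm)
  | pair (M N : Tm)
  | letp (M N : Tm)
  | fork (M : Tm)
  | new
  | send (M : Tm)
  | recv (M : Tm)
  | select (l : Label)
  | rcase (M : Tm) (L : LabelSet) (N : L.Mem → Tm)
  | close (M : Tm)
  | wait (M : Tm)

/-- Processes. `nu P` is `(νcd)P`, where in `P` the channel end `d` has index `0` and `c` has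
index `1`. -/
inductive Proc : Type
  | expr (M : Tm)
  | par (P Q : Proc)
  | nu (P : Proc)

/-- Typing environments. -/
abbrev Env : Type := List (Option Ty)

/-- Environment formation: all bindings have kind `m`. -/
inductive EnvForm (m : Mult) : Env → Prop
  | nil : EnvForm m []
  | hole {Γ : Env} : EnvForm m Γ → EnvForm m (none :: Γ)
  | cons {Γ : Env} {A : Ty} : EnvForm m Γ → HasKind m A → EnvForm m (some A :: Γ)

/-- Environment split `Γ = Γ₁ ∘ Γ₂`. -/
inductive Split : Env → Env → Env → Prop
  | nil : Split [] [] []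
  | hole {Γ Γ₁ Γ₂ : Env} : Split Γ Γ₁ Γ₂ → Split (none :: Γ) (none :: Γ₁) (none :: Γ₂)
  | both {Γ Γ₁ Γ₂ : Env} {A : Ty} :
      Split Γ Γ₁ Γ₂ → HasKind .un A → Split (some A :: Γ) (some A :: Γ₁) (some A :: Γ₂)
  | left {Γ Γ₁ Γ₂ : Env} {A : Ty} :
      Split Γ Γ₁ Γ₂ → HasKind .lin A → Split (some A :: Γ) (some A :: Γ₁) (none :: Γ₂)
  | right {Γ Γ₁ Γ₂ : Env} {A : Ty} :
      Split Γ Γ₁ Γ₂ → HasKind .lin A → Split (some A :: Γ) (none :: Γ₁) (some A :: Γ₂)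

/-- Typing derivations `Γ ⊢ M : A`. They form a type because the translation is defined on
derivations. -/
inductive Typing : Env → Tm → Ty → Type
  | name (Γ₁ Γ₂ : Env) (A : Ty) :
      EnvForm .un Γ₁ → EnvForm .un Γ₂ → Typing (Γ₂ ++ some A :: Γ₁) (.name Γ₂.length) A
  | sub {Γ : Env} {M : Tm} {A B : Ty} : Typing Γ M A → Sub A B → Typing Γ M B
  | unit {Γ : Env} : EnvForm .un Γ → Typing Γ .unit .unit
  | lam {Γ : Env} {M : Tm} {m : Mult} (A B : Ty) :
      EnvForm m Γ → Typing (some A :: Γ) M B → Typing Γ (.lam m M) (.arr m A B)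
  | app {Γ Γ₁ Γ₂ : Env} {M N : Tm} {m : Mult} {A B : Ty} :
      Split Γ Γ₁ Γ₂ → Typing Γ₁ M (.arr m A B) → Typing Γ₂ N A → Typing Γ (.app M N) B
  | pair {Γ Γ₁ Γ₂ : Env} {M N : Tm} (A B : Ty) :
      Split Γ Γ₁ Γ₂ → Typing Γ₁ M A → Typing Γ₂ N B → Typing Γ (.pair M N) (.prod A B)
  | letp {Γ Γ₁ Γ₂ : Env} {M N : Tm} {A B C : Ty} :
      Split Γ Γ₁ Γ₂ → Typing Γ₁ M (.prod A B) → Typing (some B :: some A :: Γ₂) N C →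
      Typing Γ (.letp M N) C
  | fork {Γ : Env} {M : Tm} : Typing Γ M .unit → Typing Γ (.fork M) .unit
  | new {Γ : Env} (S : Ses) : EnvForm .un Γ → Typing Γ .new (.prod (.ses S) (.ses S.dual))
  | send {Γ : Env} {M : Tm} {A : Ty} {S : Ses} :
      Typing Γ M (.ses (.send A S)) → Typing Γ (.send M) (.arr .lin A (.ses S))
  | recv {Γ : Env} {M : Tm} {A : Ty} {S : Ses} :
      Typing Γ M (.ses (.recv A S)) → Typing Γ (.recv M) (.prod A (.ses S))
  | select {Γ : Env} (L : LabelSet) (S : L.Mem → Ses) (l : L.Mem) :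
      EnvForm .un Γ →
      Typing Γ (.select l.1) (.arr .lin (.ses (.choice L S)) (.ses (S l)))
  | rcase {Γ Γ₁ Γ₂ : Env} {M : Tm} {A : Ty} (L : LabelSet) (S : L.Mem → Ses) (N : L.Mem → Tm) :
      Split Γ Γ₁ Γ₂ → Typing Γ₁ M (.ses (.branch L S)) →
      (∀ l : L.Mem, Typing (some (.ses (S l)) :: Γ₂) (N l) A) →
      Typing Γ (.rcase M L N) A
  | close {Γ : Env} {M : Tm} : Typing Γ M (.ses .endS) → Typing Γ (.close M) .unit
  | wait {Γ : Env} {M : Tm} : Typing Γ M (.ses .endR) → Typing Γ (.wait M) .unit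

/-- Process typing derivations `Γ ⊢ P`. -/
inductive ProcTyping : Env → Proc → Type
  | expr {Γ : Env} {M : Tm} : Typing Γ M .unit → ProcTyping Γ (.expr M)
  | par {Γ Γ₁ Γ₂ : Env} {P Q : Proc} :
      Split Γ Γ₁ Γ₂ → ProcTyping Γ₁ P → ProcTyping Γ₂ Q → ProcTyping Γ (.par P Q)
  | nu {Γ : Env} {P : Proc} (S : Ses) :
      ProcTyping (some (.ses S.dual) :: some (.ses S) :: Γ) P → ProcTyping Γ (.nu P)

end LSST

/-! ## The target calculus -/

namespace LDGV

mutual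
  /-- Types. `pi m A B`, `sigma A B`, `out A S`, `inn A S` are `Πₘ(x:A)B`, `Σ(x:A)B`, `!(x:A)S`,
  `?(x:A)S` and bind one name in their last argument; `eqT L V W` is `V =_L W`;
  `cas V L A` is `case V of {l : A_l}`, which binds nothing. -/
  inductive Ty : Type
    | unit
    | endT
    | lab (L : LabelSet)
    | eqT (L : LabelSet) (V W : Tm)
    | cas (V : Tm) (L : LabelSet) (A : L.Mem → Ty)
    | pi (m : Mult) (A B : Ty)
    | sigma (A B : Ty)
    | out (A S : Ty)
    | inn (A S : Ty)

  /-- Expressions, among them the values. `lam m A M` is `λₘ(x:A).M` and binds one name;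
  `pair A V N` is `⟨x:A = V, N⟩` and binds one name in `N`;
  `letp M N` is `let x, y = M in N`, where in `N` the name `y` has index `0` and `x` has index `1`;
  `cas V L N` is `case V of {l : N_l}`. -/
  inductive Tm : Type
    | name (i : ℕ)
    | lbl (l : Label)
    | unit
    | lam (m : Mult) (A : Ty) (M : Tm)
    | pair (A : Ty) (V N : Tm)
    | send (M : Tm)
    | cas (V : Tm) (L : LabelSet) (N : L.Mem → Tm)
    | app (M N : Tm)
    | letp (M N : Tm)
    | new
    | fork (M : Tm)
    | recv (M : Tm)
end

/-- The values `V, W ::= z | l | () | λₘ(x:A).M | ⟨x:A = V, W⟩ | send V`. -/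
def Tm.isVal : Tm → Bool
  | .name _ => true
  | .lbl _ => true
  | .unit => true
  | .lam _ _ _ => true
  | .pair _ V W => V.isVal && W.isVal
  | .send V => V.isVal
  | _ => false

/-- The session types among the types: `S ::= End | case V of {l : S_l} | !(x:A)S | ?(x:A)S`. -/
inductive Ty.IsSes : Ty → Prop
  | endT : Ty.IsSes .endT
  | cas {V : Tm} {L : LabelSet} {S : L.Mem → Ty} :
      (∀ l, Ty.IsSes (S l)) → Ty.IsSes (.cas V L S)
  | out {A S : Ty} : Ty.IsSes S → Ty.IsSes (.out A S)
  | inn {A S : Ty} : Ty.IsSes S → Ty.IsSes (.inn A S)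

/-- Duality, meant for session types only (the last line is never used for these). -/
def Ty.dual : Ty → Ty
  | .out A S => .inn A S.dual
  | .inn A S => .out A S.dual
  | .cas V L S => .cas V L (fun l => (S l).dual)
  | A => A

/-- A renaming under one binder. -/
def upRen (r : ℕ → ℕ) : ℕ → ℕ
  | 0 => 0
  | i + 1 => r i + 1

mutual
  /-- Renaming of names in types. -/
  def Ty.ren (r : ℕ → ℕ) : Ty → Ty
    | .unit => .unit
    | .endT => .endT
    | .lab L => .lab L
    | .eqT L V W => .eqT L (V.ren r) (W.ren r)
    | .cas V L A => .cas (V.ren r) L (fun l => (A l).ren r)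
    | .pi m A B => .pi m (A.ren r) (B.ren (upRen r))
    | .sigma A B => .sigma (A.ren r) (B.ren (upRen r))
    | .out A S => .out (A.ren r) (S.ren (upRen r))
    | .inn A S => .inn (A.ren r) (S.ren (upRen r))

  /-- Renaming of names in expressions. -/
  def Tm.ren (r : ℕ → ℕ) : Tm → Tm
    | .name i => .name (r i)
    | .lbl l => .lbl l
    | .unit => .unit
    | .lam m A M => .lam m (A.ren r) (M.ren (upRen r))
    | .pair A V N => .pair (A.ren r) (V.ren r) (N.ren (upRen r))
    | .send M => .send (M.ren r)
    | .cas V L N => .cas (V.ren r) L (fun l => (N l).ren r)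
    | .app M N => .app (M.ren r) (N.ren r)
    | .letp M N => .letp (M.ren r) (N.ren (upRen (upRen r)))
    | .new => .new
    | .fork M => .fork (M.ren r)
    | .recv M => .recv (M.ren r)
end

/-- Weakening by `k` further names. -/
def Ty.shift (k : ℕ) (A : Ty) : Ty := A.ren (fun i => i + k)

/-- Weakening by `k` further names. -/
def Tm.shift (k : ℕ) (M : Tm) : Tm := M.ren (fun i => i + k)

/-- A substitution under one binder. -/
def upSub (s : ℕ → Tm) : ℕ → Tm
  | 0 => .name 0
  | i + 1 => (s i).shift 1

mutual
  /-- Simultaneous capture-avoiding substitution in types. -/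
  def Ty.sub (s : ℕ → Tm) : Ty → Ty
    | .unit => .unit
    | .endT => .endT
    | .lab L => .lab L
    | .eqT L V W => .eqT L (V.sub s) (W.sub s)
    | .cas V L A => .cas (V.sub s) L (fun l => (A l).sub s)
    | .pi m A B => .pi m (A.sub s) (B.sub (upSub s))
    | .sigma A B => .sigma (A.sub s) (B.sub (upSub s))
    | .out A S => .out (A.sub s) (S.sub (upSub s))
    | .inn A S => .inn (A.sub s) (S.sub (upSub s))

  /-- Simultaneous capture-avoiding substitution in expressions. -/
  def Tm.sub (s : ℕ → Tm) : Tm → Tm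
    | .name i => s i
    | .lbl l => .lbl l
    | .unit => .unit
    | .lam m A M => .lam m (A.sub s) (M.sub (upSub s))
    | .pair A V N => .pair (A.sub s) (V.sub s) (N.sub (upSub s))
    | .send M => .send (M.sub s)
    | .cas V L N => .cas (V.sub s) L (fun l => (N l).sub s)
    | .app M N => .app (M.sub s) (N.sub s)
    | .letp M N => .letp (M.sub s) (N.sub (upSub (upSub s)))
    | .new => .new
    | .fork M => .fork (M.sub s)
    | .recv M => .recv (M.sub s)
end

/-- `B.inst N` is `B[N/x]`, where `x` is the name with index `0`. -/
def Ty.inst (B : Ty) (N : Tm) : Ty :=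
  B.sub (fun i => match i with
    | 0 => N
    | j + 1 => .name j)

/-- Processes. `nu P` is `(νcd)P`, where in `P` the channel end `d` has index `0` and `c` has
index `1`. -/
inductive Proc : Type
  | expr (M : Tm)
  | par (P Q : Proc)
  | nu (P : Proc)

/-- Typing environments. -/
abbrev Env : Type := List (Option Ty)

mutual
  /-- Environment formation: every binding has kind `m` in the unrestricted part of the
  environment before it. -/
  inductive EnvForm : Mult → Env → Prop
    | nil {m : Mult} : EnvForm m []
    | hole {m : Mult} {Γ : Env} : EnvForm m Γ → EnvForm m (none :: Γ)
    | cons {m : Mult} {Γ Δ : Env} {A : Ty} :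
        EnvForm m Γ → Unr Γ Δ → HasKind Δ A m → EnvForm m (some A :: Γ)

  /-- `Unr Γ Δ`: the unrestricted part of `Γ` is `Δ`. -/
  inductive Unr : Env → Env → Prop
    | nil : Unr [] []
    | hole {Γ Δ : Env} : Unr Γ Δ → Unr (none :: Γ) (none :: Δ)
    | cons {Γ Γ' Δ : Env} {A : Ty} : Unr Γ Γ' → CondExt Γ' A Δ → Unr (some A :: Γ) Δ

  /-- `CondExt Γ A Δ`: the conditional extension of `Γ` by a binding of type `A` is `Δ`. -/
  inductive CondExt : Env → Ty → Env → Prop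
    | lin {Γ Δ : Env} {A : Ty} : Unr Γ Δ → HasKind Δ A .lin → CondExt Γ A (none :: Γ)
    | un {Γ Δ : Env} {A : Ty} : Unr Γ Δ → HasKind Δ A .un → CondExt Γ A (some A :: Γ)

  /-- Environment split `Γ = Γ₁ ∘ Γ₂`. -/
  inductive Split : Env → Env → Env → Prop
    | nil : Split [] [] []
    | hole {Γ Γ₁ Γ₂ : Env} : Split Γ Γ₁ Γ₂ → Split (none :: Γ) (none :: Γ₁) (none :: Γ₂)
    | both {Γ Γ₁ Γ₂ Δ₁ Δ₂ : Env} {A : Ty} :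
        Split Γ Γ₁ Γ₂ → Unr Γ₁ Δ₁ → HasKind Δ₁ A .un → Unr Γ₂ Δ₂ → HasKind Δ₂ A .un →
        Split (some A :: Γ) (some A :: Γ₁) (some A :: Γ₂)
    | left {Γ Γ₁ Γ₂ Δ₁ : Env} {A : Ty} :
        Split Γ Γ₁ Γ₂ → Unr Γ₁ Δ₁ → HasKind Δ₁ A .lin →
        Split (some A :: Γ) (some A :: Γ₁) (none :: Γ₂)
    | right {Γ Γ₁ Γ₂ Δ₂ : Env} {A : Ty} :
        Split Γ Γ₁ Γ₂ → Unr Γ₂ Δ₂ → HasKind Δ₂ A .lin →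
        Split (some A :: Γ) (none :: Γ₁) (some A :: Γ₂)

  /-- Type formation `Γ ⊢ A : m`. -/
  inductive HasKind : Env → Ty → Mult → Prop
    | eqT {Γ : Env} {L : LabelSet} {V W : Tm} :
        V.isVal = true → W.isVal = true → Typing Γ V (.lab L) → Typing Γ W (.lab L) →
        HasKind Γ (.eqT L V W) .un
    | unit {Γ : Env} : EnvForm .un Γ → HasKind Γ .unit .un
    | endT {Γ : Env} : EnvForm .un Γ → HasKind Γ .endT .un
    | lab {Γ : Env} {L : LabelSet} : EnvForm .un Γ → HasKind Γ (.lab L) .un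
    | cas {Γ : Env} {V : Tm} {L : LabelSet} {A : L.Mem → Ty} {m : Mult} :
        V.isVal = true → Typing Γ V (.lab L) →
        (∀ l : L.Mem, HasKind (some (.eqT L V (.lbl l.1)) :: Γ) ((A l).shift 1) m) →
        HasKind Γ (.cas V L A) m
    | pi {Γ Δ : Env} {A B : Ty} {m n k : Mult} :
        HasKind Γ A n → CondExt Γ A Δ → HasKind Δ B k → HasKind Γ (.pi m A B) m
    | sigma {Γ Δ : Env} {A B : Ty} {m : Mult} :
        HasKind Γ A m → CondExt Γ A Δ → HasKind Δ B m → HasKind Γ (.sigma A B) m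
    | out {Γ Δ : Env} {A S : Ty} {m n : Mult} :
        HasKind Γ A m → CondExt Γ A Δ → S.IsSes → HasKind Δ S n → HasKind Γ (.out A S) .lin
    | inn {Γ Δ : Env} {A S : Ty} {m n : Mult} :
        HasKind Γ A m → CondExt Γ A Δ → S.IsSes → HasKind Δ S n → HasKind Γ (.inn A S) .lin
    | sub {Γ : Env} {A : Ty} {m n : Mult} : HasKind Γ A m → m.Le n → HasKind Γ A n

  /-- Type conversion `Γ ⊢ A ≡ B : m`. -/
  inductive Conv : Env → Ty → Ty → Mult → Prop
    | subst {Γ : Env} {L : LabelSet} {U V W : Tm} {A : Ty} {m : Mult} :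
        HasKind (some (.lab L) :: Γ) A m → U.isVal = true → Typing Γ U (.eqT L V W) →
        Conv Γ (A.inst V) (A.inst W) m
    | beta {Γ : Env} {L : LabelSet} {A : L.Mem → Ty} {m : Mult} (l : L.Mem) :
        (∀ k : L.Mem, HasKind Γ (A k) m) → Conv Γ (.cas (.lbl l.1) L A) (A l) m
    | eta {Γ : Env} {V : Tm} {L : LabelSet} {A : Ty} {m : Mult} :
        V.isVal = true → Typing Γ V (.lab L) → HasKind Γ A m →
        Conv Γ A (.cas V L (fun _ => A)) m
    | refl {Γ : Env} {A : Ty} {m : Mult} : HasKind Γ A m → Conv Γ A A m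
    | symm {Γ : Env} {A B : Ty} {m : Mult} : Conv Γ A B m → Conv Γ B A m
    | trans {Γ : Env} {A B C : Ty} {m : Mult} : Conv Γ A B m → Conv Γ B C m → Conv Γ A C m

  /-- Subtyping `Γ ⊢ A ≤ B : m`. -/
  inductive Sub : Env → Ty → Ty → Mult → Prop
    | conv {Γ : Env} {A B : Ty} {m : Mult} : Conv Γ A B m → Sub Γ A B m
    | lab {Γ : Env} {L L' : LabelSet} :
        EnvForm .un Γ → L.1 ⊆ L'.1 → Sub Γ (.lab L) (.lab L') .un
    | trans {Γ : Env} {A B C : Ty} {m : Mult} : Sub Γ A B m → Sub Γ B C m → Sub Γ A C m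
    | sub {Γ : Env} {A B : Ty} {m n : Mult} : Sub Γ A B m → m.Le n → Sub Γ A B n
    | pi {Γ Δ : Env} {A A' B B' : Ty} {m m' n k : Mult} :
        Sub Γ A' A n → CondExt Γ A' Δ → Sub Δ B B' k → m.Le m' →
        Sub Γ (.pi m A B) (.pi m' A' B') m'
    | sigma {Γ Δ : Env} {A A' B B' : Ty} {m : Mult} :
        Sub Γ A A' m → CondExt Γ A Δ → Sub Δ B B' m → Sub Γ (.sigma A B) (.sigma A' B') m
    | out {Γ Δ : Env} {A A' S S' : Ty} {m n : Mult} :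
        Sub Γ A' A m → CondExt Γ A' Δ → S.IsSes → S'.IsSes → Sub Δ S S' n →
        Sub Γ (.out A S) (.out A' S') .lin
    | inn {Γ Δ : Env} {A A' S S' : Ty} {m n : Mult} :
        Sub Γ A A' m → CondExt Γ A Δ → S.IsSes → S'.IsSes → Sub Δ S S' n →
        Sub Γ (.inn A S) (.inn A' S') .lin
    | cas {Γ : Env} {V : Tm} {K L L' : LabelSet} {A : L.Mem → Ty} {A' : L'.Mem → Ty} {m : Mult} :
        V.isVal = true → K.1 = L.1 ∩ L'.1 → Typing Γ V (.lab K) →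
        (∀ (l : Label) (h : l ∈ L.1) (h' : l ∈ L'.1),
          Sub (some (.eqT K V (.lbl l)) :: Γ) ((A ⟨l, h⟩).shift 1) ((A' ⟨l, h'⟩).shift 1) m) →
        Sub Γ (.cas V L A) (.cas V L' A') m

  /-- Expression formation `Γ ⊢ M : A`. -/
  inductive Typing : Env → Tm → Ty → Prop
    | sub {Γ Δ : Env} {M : Tm} {A B : Ty} {m : Mult} :
        Typing Γ M A → Unr Γ Δ → Sub Δ A B m → Typing Γ M B
    /-- `Γ₁, z : A, Γ₂ ⊢ z : A`: all bindings other than `z : A` are unrestricted. -/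
    | name {Γ₁ Γ₂ Δ : Env} {A : Ty} :
        CondExt Γ₁ A Δ → EnvForm .un (Γ₂ ++ Δ) →
        Typing (Γ₂ ++ some A :: Γ₁) (.name Γ₂.length) (A.shift (Γ₂.length + 1))
    | unit {Γ : Env} : EnvForm .un Γ → Typing Γ .unit .unit
    | lbl {Γ : Env} {L : LabelSet} (l : L.Mem) :
        HasKind Γ (.lab L) .un → Typing Γ (.lbl l.1) (.lab L)
    | cas {Γ Δ : Env} {V : Tm} {L : LabelSet} {N : L.Mem → Tm} {B : Ty} :
        V.isVal = true → Unr Γ Δ → Typing Δ V (.lab L) →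
        (∀ l : L.Mem,
          Typing (some (.eqT L V (.lbl l.1)) :: Γ) ((N l).shift 1) (B.shift 1)) →
        Typing Γ (.cas V L N) B
    | lam {Γ : Env} {M : Tm} {A B : Ty} {m : Mult} :
        EnvForm m Γ → Typing (some A :: Γ) M B → Typing Γ (.lam m A M) (.pi m A B)
    | app {Γ Γ₁ Γ₂ Δ : Env} {M N : Tm} {A B : Ty} {m n : Mult} :
        Split Γ Γ₁ Γ₂ → Typing Γ₁ M (.pi m A B) → Typing Γ₂ N A →
        Unr Γ Δ → HasKind Δ (B.inst N) n → Typing Γ (.app M N) (B.inst N)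
    /-- The first component may be used in the second one if it is unrestricted. -/
    | pair {Γ Γ₁ Γ₂ Δ Δ₂ : Env} {V N : Tm} {A B : Ty} {m : Mult} :
        Split Γ Γ₁ Γ₂ → Unr Γ Δ → HasKind Δ (.sigma A B) m →
        V.isVal = true → Typing Γ₁ V A → CondExt Γ₂ A Δ₂ → Typing Δ₂ N B →
        Typing Γ (.pair A V N) (.sigma A B)
    /-- If the first component is a label, the second one may use its defining equation. -/
    | pairLab {Γ Γ₁ Γ₂ Δ : Env} {V N : Tm} {L : LabelSet} {B : Ty} {m : Mult} :
        Split Γ Γ₁ Γ₂ → Unr Γ Δ → HasKind Δ (.sigma (.lab L) B) m →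
        V.isVal = true → Typing Γ₁ V (.lab L) →
        Typing (some (.eqT L (.name 0) (V.shift 1)) :: some (.lab L) :: Γ₂)
          (N.shift 1) (B.shift 1) →
        Typing Γ (.pair (.lab L) V N) (.sigma (.lab L) B)
    | letp {Γ Γ₁ Γ₂ Δ : Env} {M N : Tm} {A B C : Ty} {m : Mult} :
        Split Γ Γ₁ Γ₂ → Typing Γ₁ M (.sigma A B) →
        Typing (some B :: some A :: Γ₂) N (C.shift 2) →
        Unr Γ Δ → HasKind Δ C m → Typing Γ (.letp M N) C
    /-- Elimination of a pair with a label in front: the body is checked once for each label. -/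
    | letpLab {Γ Γ₁ Γ₂ Δ : Env} {M N : Tm} {L : LabelSet} {B C : Ty} {m n : Mult} :
        Split Γ Γ₁ Γ₂ → Typing Γ₁ M (.sigma (.lab L) B) →
        Unr Γ Δ → HasKind (some (.lab L) :: Δ) B n → HasKind Δ C m →
        Typing (some B :: some (.lab L) :: Γ₂) (.cas (.name 1) L (fun _ => N)) (C.shift 2) →
        Typing Γ (.letp M N) C
    | fork {Γ : Env} {M : Tm} : Typing Γ M .unit → Typing Γ (.fork M) .unit
    | new {Γ : Env} {S : Ty} {m : Mult} :
        S.IsSes → HasKind Γ S m → Typing Γ .new (.sigma S (S.dual.shift 1))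
    | send {Γ : Env} {M : Tm} {A S : Ty} :
        Typing Γ M (.out A S) → Typing Γ (.send M) (.pi .lin A S)
    | recv {Γ : Env} {M : Tm} {A S : Ty} :
        Typing Γ M (.inn A S) → Typing Γ (.recv M) (.sigma A S)
end

/-- Process formation `Γ ⊢ P`. -/
inductive ProcTyping : Env → Proc → Prop
  | expr {Γ : Env} {M : Tm} : Typing Γ M .unit → ProcTyping Γ (.expr M)
  | par {Γ Γ₁ Γ₂ : Env} {P Q : Proc} :
      Split Γ Γ₁ Γ₂ → ProcTyping Γ₁ P → ProcTyping Γ₂ Q → ProcTyping Γ (.par P Q)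
  | nu {Γ Δ : Env} {P : Proc} {S : Ty} {m : Mult} :
      Unr Γ Δ → S.IsSes → HasKind Δ S m →
      ProcTyping (some (S.dual.shift 1) :: some S :: Γ) P → ProcTyping Γ (.nu P)

end LDGV

/-! ## The translation -/

namespace Embed

mutual
  /-- Translation of types. Translated types are closed, hence they need no shift under binders. -/
  def ty : LSST.Ty → LDGV.Ty
    | .ses S => ses S
    | .unit => .unit
    | .arr m A B => .pi m (ty A) (ty B)
    | .prod A B => .sigma (ty A) (ty B)

  /-- Translation of session types. -/
  def ses : LSST.Ses → LDGV.Ty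
    | .send A S => .out (ty A) (ses S)
    | .recv A S => .inn (ty A) (ses S)
    | .choice L S => .out (.lab L) (.cas (.name 0) L (fun l => ses (S l)))
    | .branch L S => .inn (.lab L) (.cas (.name 0) L (fun l => ses (S l)))
    | .endS => .out (.lab eosSet) .endT
    | .endR => .inn (.lab eosSet) .endT
end

/-- Translation of environments. -/
def env (Γ : LSST.Env) : LDGV.Env := Γ.map (Option.map ty)

/-- The pair of the translations `M : A` and `N`. The first component of a pair is a value in the
target calculus, so a first component that is not a value is evaluated and named beforehand:
`(λ(x:A).⟨y:A = x, N⟩) M`. -/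
def pair (A : LDGV.Ty) (M N : LDGV.Tm) : LDGV.Tm :=
  if M.isVal then .pair A M (N.shift 1)
  else .app (.lam .lin A (.pair A (.name 0) (N.shift 2))) M

/-- Translation of typing derivations to expressions. -/
def tm {Γ : LSST.Env} {M : LSST.Tm} {A : LSST.Ty} : LSST.Typing Γ M A → LDGV.Tm
  | .name _ Γ₂ _ _ _ => .name Γ₂.length
  | .sub d _ => tm d
  | .unit _ => .unit
  | .lam (m := m) A _ _ d => .lam m (ty A) (tm d)
  | .app _ d e => .app (tm d) (tm e)
  | .pair A _ _ d e => pair (ty A) (tm d) (tm e)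
  | .letp _ d e => .letp (tm d) (tm e)
  | .fork d => .fork (tm d)
  | .new _ _ => .new
  | .send d => .send (tm d)
  | .recv d => .recv (tm d)
  | .select L S l _ => .lam .lin (ses (.choice L S)) (.app (.send (.name 0)) (.lbl l.1))
  -- `let x, y = recv M in case x of {l : N_l}`; the branch `N_l` knows `y` but not `x`
  | .rcase L _ _ _ d e =>
      .letp (.recv (tm d)) (.cas (.name 1) L (fun l => (tm (e l)).ren (LDGV.upRen Nat.succ)))
  -- `send M EOS`, whose result, the exhausted channel of type `End`, is dropped
  | .close d => .app (.lam .lin .endT .unit) (.app (.send (tm d)) (.lbl eos))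
  -- `let x, y = recv M in ()`
  | .wait d => .letp (.recv (tm d)) .unit

/-- Translation of typing derivations to processes. -/
def proc {Γ : LSST.Env} {P : LSST.Proc} : LSST.ProcTyping Γ P → LDGV.Proc
  | .expr d => .expr (tm d)
  | .par _ d e => .par (proc d) (proc e)
  | .nu _ d => .nu (proc d)

end Embed

open LDGV

-- The translation is compositional, so the proof is an induction on the source derivation; the
-- obstacle is `rcase`. In the source, branch `l` sees the received channel at type `S l`. In the
-- target it sees a label `x`, the channel at type `case x of {l : ⟦S l⟧}`, and an equation `x = l`.
-- The induction hypothesis `tm_typing` is therefore stated for every target environment that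
-- realizes the source environment (`Realizes`), with the translated term renamed into it. This
-- generality takes the place of weakening and substitution lemmas for target typing.
--
-- Three facts keep the dependency harmless. Translated types are closed (`ty_ren`, `ty_sub`), so
-- neither binders nor the substitution in the application rule affect them. Every translated type
-- has kind `lin` in every unrestricted environment (`ty_hasKind_lin`), whether or not it also has
-- kind `un`. A conditional extension may therefore always drop it, and each realization has an
-- unrestricted part `Δ` consisting of labels and equations only, which survives every split
-- unchanged (`Realizes.unr`, `Realizes.split`). Finally, an equation `x = l` in `Δ` converts the
-- case type of a channel to `⟦S l⟧` (`casSes_sub_of_eq`); it is spent only when a name is looked up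
-- (`Realizes.lookup`, `Realizes.typing_name`).

theorem Mult.le_lin (m : Mult) : m.Le .lin := by
  cases m <;> constructor

/-! ## Renaming -/

namespace LDGV

theorem upRen_id : upRen id = id := by
  funext i; cases i <;> rfl

theorem upRen_comp (r s : ℕ → ℕ) : upRen (s ∘ r) = upRen s ∘ upRen r := by
  funext i; cases i <;> rfl

mutual
  theorem Ty.ren_id : ∀ A : Ty, A.ren id = A
    | .unit | .endT | .lab _ => by simp [Ty.ren]
    | .eqT _ V W => by simp [Ty.ren, Tm.ren_id V, Tm.ren_id W]
    | .cas V L A => by simp [Ty.ren, Tm.ren_id V, fun l => Ty.ren_id (A l)]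
    | .pi _ A B | .sigma A B | .out A B | .inn A B => by
        simp [Ty.ren, upRen_id, Ty.ren_id A, Ty.ren_id B]

  theorem Tm.ren_id : ∀ M : Tm, M.ren id = M
    | .name _ | .lbl _ | .unit | .new => by simp [Tm.ren]
    | .lam _ A M => by simp [Tm.ren, upRen_id, Ty.ren_id A, Tm.ren_id M]
    | .pair A V N => by simp [Tm.ren, upRen_id, Ty.ren_id A, Tm.ren_id V, Tm.ren_id N]
    | .send M | .fork M | .recv M => by simp [Tm.ren, Tm.ren_id M]
    | .cas V L N => by simp [Tm.ren, Tm.ren_id V, fun l => Tm.ren_id (N l)]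
    | .app M N | .letp M N => by simp [Tm.ren, upRen_id, Tm.ren_id M, Tm.ren_id N]
end

mutual
  theorem Ty.ren_ren (r s : ℕ → ℕ) : ∀ A : Ty, (A.ren r).ren s = A.ren (s ∘ r)
    | .unit | .endT | .lab _ => by simp [Ty.ren]
    | .eqT _ V W => by simp [Ty.ren, Tm.ren_ren r s V, Tm.ren_ren r s W]
    | .cas V L A => by simp [Ty.ren, Tm.ren_ren r s V, fun l => Ty.ren_ren r s (A l)]
    | .pi _ A B | .sigma A B | .out A B | .inn A B => by
        simp [Ty.ren, upRen_comp, Ty.ren_ren r s A, Ty.ren_ren (upRen r) (upRen s) B]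

  theorem Tm.ren_ren (r s : ℕ → ℕ) : ∀ M : Tm, (M.ren r).ren s = M.ren (s ∘ r)
    | .name _ | .lbl _ | .unit | .new => by simp [Tm.ren]
    | .lam _ A M => by
        simp [Tm.ren, upRen_comp, Ty.ren_ren r s A, Tm.ren_ren (upRen r) (upRen s) M]
    | .pair A V N => by
        simp [Tm.ren, upRen_comp, Ty.ren_ren r s A, Tm.ren_ren r s V,
          Tm.ren_ren (upRen r) (upRen s) N]
    | .send M | .fork M | .recv M => by simp [Tm.ren, Tm.ren_ren r s M]
    | .cas V L N => by simp [Tm.ren, Tm.ren_ren r s V, fun l => Tm.ren_ren r s (N l)]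
    | .app M N => by simp [Tm.ren, Tm.ren_ren r s M, Tm.ren_ren r s N]
    | .letp M N => by
        simp [Tm.ren, upRen_comp, Tm.ren_ren r s M,
          Tm.ren_ren (upRen (upRen r)) (upRen (upRen s)) N]
end

theorem Tm.isVal_ren : ∀ (M : Tm) (r : ℕ → ℕ), (M.ren r).isVal = M.isVal
  | .name _, _ | .lbl _, _ | .unit, _ | .new, _ | .lam _ _ _, _ | .fork _, _ | .recv _, _
  | .cas _ _ _, _ | .app _ _, _ | .letp _ _, _ => by simp [Tm.ren, Tm.isVal]
  | .pair A V N, r => by simp [Tm.ren, Tm.isVal, Tm.isVal_ren V, Tm.isVal_ren N]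
  | .send M, r => by simp [Tm.ren, Tm.isVal, Tm.isVal_ren M]

/-! ## Unrestricted environments -/

theorem EnvForm.lin_of_un : ∀ {Γ : Env}, EnvForm .un Γ → EnvForm .lin Γ
  | _, .nil => .nil
  | _, .hole h => .hole h.lin_of_un
  | _, .cons h hu hk => .cons h.lin_of_un hu (.sub hk .un_lin)

/-- A well-formed unrestricted environment, which is its own unrestricted part. -/
structure Unrestricted (Δ : Env) : Prop where
  form : EnvForm .un Δ
  unr : Unr Δ Δ

theorem Unrestricted.nil : Unrestricted [] := ⟨.nil, .nil⟩

theorem Unrestricted.hole {Δ : Env} (h : Unrestricted Δ) : Unrestricted (none :: Δ) :=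
  ⟨.hole h.form, .hole h.unr⟩

theorem Unrestricted.cons {Δ : Env} {A : Ty} (h : Unrestricted Δ) (hA : HasKind Δ A .un) :
    Unrestricted (some A :: Δ) :=
  ⟨.cons h.form h.unr hA, .cons h.unr (.un h.unr hA)⟩

theorem Unrestricted.lab {Δ : Env} (h : Unrestricted Δ) (L : LabelSet) :
    Unrestricted (some (.lab L) :: Δ) :=
  h.cons (.lab h.form)

/-- Subkinding gives unrestricted types the kind `lin` too, so this applies to every well-formed
type: a conditional extension may drop any binding. -/
theorem Unrestricted.condExt_lin {Δ : Env} {A : Ty} (h : Unrestricted Δ)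
    (hA : HasKind Δ A .lin) : CondExt Δ A (none :: Δ) :=
  .lin h.unr hA

theorem Unrestricted.condExt_lab {Δ : Env} (h : Unrestricted Δ) (L : LabelSet) :
    CondExt Δ (.lab L) (some (.lab L) :: Δ) :=
  .un h.unr (.lab h.form)

-- Names in target environments

/-- `HasVar Γ i A`: the name with index `i` has type `A` in `Γ`. -/
inductive HasVar : Env → ℕ → Ty → Prop
  | here {Γ : Env} {A : Ty} : HasVar (some A :: Γ) 0 (A.shift 1)
  | there {Γ : Env} {i : ℕ} {A : Ty} (o : Option Ty) :
      HasVar Γ i A → HasVar (o :: Γ) (i + 1) (A.shift 1)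

theorem Ty.shift_shift (A : Ty) (j k : ℕ) : (A.shift j).shift k = A.shift (j + k) := by
  simp only [Ty.shift, Ty.ren_ren]
  congr 1
  funext i
  simp [Nat.add_assoc]

/-- Connects step-by-step lookup, which is easy to build and to weaken, with the list decomposition
in which the name rule is phrased. -/
theorem HasVar.exists_append {Γ : Env} {i : ℕ} {A : Ty} (h : HasVar Γ i A) :
    ∃ (Γ₁ Γ₂ : Env) (B : Ty), Γ = Γ₂ ++ some B :: Γ₁ ∧ i = Γ₂.length ∧
      A = B.shift (Γ₂.length + 1) := by
  induction h with
  | @here Γ A => exact ⟨Γ, [], A, rfl, rfl, rfl⟩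
  | there o _ ih =>
    obtain ⟨Γ₁, Γ₂, B, rfl, rfl, rfl⟩ := ih
    exact ⟨Γ₁, o :: Γ₂, B, rfl, rfl, by simp [Ty.shift_shift]⟩

theorem EnvForm.of_append {m : Mult} {Γ₁ : Env} :
    ∀ {Γ₂ : Env}, EnvForm m (Γ₂ ++ Γ₁) → EnvForm m Γ₁
  | [], h => h
  | none :: _, .hole h => EnvForm.of_append h
  | some _ :: _, .cons h _ _ => EnvForm.of_append h

theorem HasVar.typing {Γ : Env} {i : ℕ} {A : Ty} (h : HasVar Γ i A) (hΓ : EnvForm .un Γ) :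
    Typing Γ (.name i) A := by
  obtain ⟨Γ₁, Γ₂, B, rfl, rfl, rfl⟩ := h.exists_append
  cases hΓ.of_append with
  | cons _ hu hk => exact .name (.un hu hk) hΓ

/-- The binding is treated as linear, so the conditional extension leaves a hole and only the rest
has to be unrestricted. -/
theorem Typing.name_zero {Γ Δ : Env} {A : Ty} (hΓ : EnvForm .un Γ) (hu : Unr Γ Δ)
    (hA : HasKind Δ A .lin) : Typing (some A :: Γ) (.name 0) (A.shift 1) :=
  .name (Γ₂ := []) (.lin hu hA) (.hole hΓ)

theorem Typing.of_mem {Γ : Env} {L : LabelSet} (hΓ : EnvForm .un Γ) (l : L.Mem) :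
    Typing Γ (.lbl l.1) (.lab L) :=
  .lbl l (.lab hΓ)

theorem HasKind.eqT_lbl {Γ : Env} {L : LabelSet} {V : Tm} (hΓ : EnvForm .un Γ)
    (hv : V.isVal = true) (hV : Typing Γ V (.lab L)) (l : L.Mem) :
    HasKind Γ (.eqT L V (.lbl l.1)) .un :=
  .eqT hv rfl hV (.of_mem hΓ l)

end LDGV

/-! ## Source kinds -/

namespace LSST

theorem Ty.hasKind_lin : ∀ A : Ty, HasKind .lin A
  | .ses S => .ses S
  | .unit => .sub .unit .un_lin
  | .arr m A B => .sub (.arr m A B) m.le_lin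
  | .prod A B => .prod A.hasKind_lin B.hasKind_lin

theorem Env.form_lin : ∀ Γ : Env, EnvForm .lin Γ
  | [] => .nil
  | none :: Γ => .hole (Env.form_lin Γ)
  | some A :: Γ => .cons (Env.form_lin Γ) A.hasKind_lin

/-- Nothing lies above `lin`, so raising the kind of a session type never leaves it. The type is
generalized by an equation because inversion has to pass through the subkinding rule. -/
theorem HasKind.eq_lin_of_ses {m : Mult} {A : Ty} (h : HasKind m A) :
    ∀ {S : Ses}, A = .ses S → m = .lin := by
  induction h with
  | ses => intros; rfl
  | sub _ hle ih =>
    intro S hS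
    cases ih hS
    cases hle
    rfl
  | _ => intro S hS; cases hS

theorem HasKind.ses_un_elim {S : Ses} {p : Prop} (h : HasKind .un (.ses S)) : p := by
  cases h.eq_lin_of_ses rfl

end LSST

/-! ## Translated types -/

namespace Embed

-- Translated types are closed: the only name they mention is the label bound by a choice or a
-- branch, and a renaming under a binder fixes index `0`.
mutual
  theorem ty_ren (r : ℕ → ℕ) : ∀ A : LSST.Ty, (ty A).ren r = ty A
    | .ses S => by simp only [ty, ses_ren r S]
    | .unit => by simp only [ty, Ty.ren]
    | .arr m A B => by simp only [ty, Ty.ren, ty_ren _ A, ty_ren _ B]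
    | .prod A B => by simp only [ty, Ty.ren, ty_ren _ A, ty_ren _ B]

  theorem ses_ren (r : ℕ → ℕ) : ∀ S : LSST.Ses, (ses S).ren r = ses S
    | .send A S => by simp only [ses, Ty.ren, ty_ren _ A, ses_ren _ S]
    | .recv A S => by simp only [ses, Ty.ren, ty_ren _ A, ses_ren _ S]
    | .choice L S => by simp only [ses, Ty.ren, Tm.ren, upRen, fun l => ses_ren (upRen r) (S l)]
    | .branch L S => by simp only [ses, Ty.ren, Tm.ren, upRen, fun l => ses_ren (upRen r) (S l)]
    | .endS => by simp only [ses, Ty.ren]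
    | .endR => by simp only [ses, Ty.ren]
end

mutual
  theorem ty_sub (s : ℕ → Tm) : ∀ A : LSST.Ty, (ty A).sub s = ty A
    | .ses S => by simp only [ty, ses_sub s S]
    | .unit => by simp only [ty, Ty.sub]
    | .arr m A B => by simp only [ty, Ty.sub, ty_sub _ A, ty_sub _ B]
    | .prod A B => by simp only [ty, Ty.sub, ty_sub _ A, ty_sub _ B]

  theorem ses_sub (s : ℕ → Tm) : ∀ S : LSST.Ses, (ses S).sub s = ses S
    | .send A S => by simp only [ses, Ty.sub, ty_sub _ A, ses_sub _ S]
    | .recv A S => by simp only [ses, Ty.sub, ty_sub _ A, ses_sub _ S]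
    | .choice L S => by simp only [ses, Ty.sub, Tm.sub, upSub, fun l => ses_sub (upSub s) (S l)]
    | .branch L S => by simp only [ses, Ty.sub, Tm.sub, upSub, fun l => ses_sub (upSub s) (S l)]
    | .endS => by simp only [ses, Ty.sub]
    | .endR => by simp only [ses, Ty.sub]
end

theorem ty_shift (k : ℕ) (A : LSST.Ty) : (ty A).shift k = ty A := ty_ren _ A

theorem ses_shift (k : ℕ) (S : LSST.Ses) : (ses S).shift k = ses S := ses_ren _ S

theorem ty_inst (A : LSST.Ty) (N : Tm) : (ty A).inst N = ty A := ty_sub _ A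

theorem ses_isSes : ∀ S : LSST.Ses, (ses S).IsSes
  | .send A S => by simpa only [ses] using .out (ses_isSes S)
  | .recv A S => by simpa only [ses] using .inn (ses_isSes S)
  | .choice L S => by simpa only [ses] using .out (.cas fun l => ses_isSes (S l))
  | .branch L S => by simpa only [ses] using .inn (.cas fun l => ses_isSes (S l))
  | .endS => by simpa only [ses] using .out .endT
  | .endR => by simpa only [ses] using .inn .endT

theorem ses_dual : ∀ S : LSST.Ses, ses S.dual = (ses S).dual
  | .send A S => by simp only [ses, LSST.Ses.dual, Ty.dual, ses_dual S]
  | .recv A S => by simp only [ses, LSST.Ses.dual, Ty.dual, ses_dual S]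
  | .choice L S => by simp only [ses, LSST.Ses.dual, Ty.dual, fun l => ses_dual (S l)]
  | .branch L S => by simp only [ses, LSST.Ses.dual, Ty.dual, fun l => ses_dual (S l)]
  | .endS => by simp only [ses, LSST.Ses.dual, Ty.dual]
  | .endR => by simp only [ses, LSST.Ses.dual, Ty.dual]

-- Case types, and kinds of translated types

/-- The label-dependent session type `case V of {l : ⟦S_l⟧}`. -/
abbrev casSes (V : Tm) (L : LabelSet) (S : L.Mem → LSST.Ses) : Ty :=
  .cas V L (fun l => ses (S l))

theorem casSes_shift (k : ℕ) (V : Tm) (L : LabelSet) (S : L.Mem → LSST.Ses) :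
    (casSes V L S).shift k = casSes (V.shift k) L S := by
  simp only [Ty.shift, Tm.shift, Ty.ren, ses_ren]

theorem casSes_inst (L : LabelSet) (S : L.Mem → LSST.Ses) (N : Tm) :
    (casSes (.name 0) L S).inst N = casSes N L S := by
  simp only [Ty.inst, Ty.sub, Tm.sub, ses_sub]

/-- The branches are closed, so they only need to be well formed in every unrestricted environment,
including the one extended by the equation of the branch. Formation of the branches is a hypothesis
so that the mutual recursion below can use the lemma. -/
theorem hasKind_cas_of_forall {Δ : Env} (h : Unrestricted Δ) {V : Tm} {L : LabelSet}
    {S : L.Mem → LSST.Ses}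
    (ih : ∀ (l : L.Mem) (Δ : Env), Unrestricted Δ → HasKind Δ (ses (S l)) .lin)
    (hv : V.isVal = true) (hV : Typing Δ V (.lab L)) : HasKind Δ (casSes V L S) .lin :=
  .cas hv hV fun l => by
    rw [ses_shift]
    exact ih l _ (h.cons (.eqT_lbl h.form hv hV l))

theorem typing_lab_zero {Δ : Env} (h : Unrestricted Δ) (L : LabelSet) :
    Typing (some (.lab L) :: Δ) (.name 0) (.lab L) :=
  HasVar.here.typing (h.lab L).form

-- Payloads and domains are replaced by holes because what follows does not mention them. For a
-- choice or a branch the bound label is kept, since it is the scrutinee.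
mutual
  theorem ty_hasKind_lin : ∀ (A : LSST.Ty) (Δ : Env), Unrestricted Δ → HasKind Δ (ty A) .lin
    | .ses S, Δ, h => by simpa only [ty] using ses_hasKind S Δ h
    | .unit, Δ, h => by simpa only [ty] using .sub (.unit h.form) .un_lin
    | .arr m A B, Δ, h => by
        have hA := ty_hasKind_lin A Δ h
        have := HasKind.pi (m := m) hA (h.condExt_lin hA) (ty_hasKind_lin B _ h.hole)
        simpa only [ty] using .sub this m.le_lin
    | .prod A B, Δ, h => by
        have hA := ty_hasKind_lin A Δ h
        simpa only [ty] using .sigma hA (h.condExt_lin hA) (ty_hasKind_lin B _ h.hole)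

  theorem ses_hasKind : ∀ (S : LSST.Ses) (Δ : Env), Unrestricted Δ → HasKind Δ (ses S) .lin
    | .send A S, Δ, h => by
        have hA := ty_hasKind_lin A Δ h
        simpa only [ses] using
          .out hA (h.condExt_lin hA) (ses_isSes S) (ses_hasKind S _ h.hole)
    | .recv A S, Δ, h => by
        have hA := ty_hasKind_lin A Δ h
        simpa only [ses] using
          .inn hA (h.condExt_lin hA) (ses_isSes S) (ses_hasKind S _ h.hole)
    | .choice L S, Δ, h => by
        simpa only [ses] using
          .out (.lab h.form) (h.condExt_lab L) (.cas fun l => ses_isSes (S l))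
            (hasKind_cas_of_forall (h.lab L) (fun l => ses_hasKind (S l)) rfl
              (typing_lab_zero h L))
    | .branch L S, Δ, h => by
        simpa only [ses] using
          .inn (.lab h.form) (h.condExt_lab L) (.cas fun l => ses_isSes (S l))
            (hasKind_cas_of_forall (h.lab L) (fun l => ses_hasKind (S l)) rfl
              (typing_lab_zero h L))
    | .endS, Δ, h => by
        simpa only [ses] using
          .out (.lab h.form) (h.condExt_lab _) .endT (.endT (h.lab _).form)
    | .endR, Δ, h => by
        simpa only [ses] using
          .inn (.lab h.form) (h.condExt_lab _) .endT (.endT (h.lab _).form)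
end

theorem casSes_hasKind {Δ : Env} (h : Unrestricted Δ) {V : Tm} {L : LabelSet}
    (S : L.Mem → LSST.Ses) (hv : V.isVal = true) (hV : Typing Δ V (.lab L)) :
    HasKind Δ (casSes V L S) .lin :=
  hasKind_cas_of_forall h (fun l => ses_hasKind (S l)) hv hV

/-- The exact kind is needed where `un` and `lin` differ: in splits and in environment formation. -/
theorem ty_hasKind {m : Mult} {A : LSST.Ty} (hA : LSST.HasKind m A) :
    ∀ {Δ : Env}, Unrestricted Δ → HasKind Δ (ty A) m := by
  induction hA with
  | unit => intro Δ h; simpa only [ty] using .unit h.form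
  | arr m A B =>
    intro Δ h
    have hA := ty_hasKind_lin A Δ h
    simpa only [ty] using .pi hA (h.condExt_lin hA) (ty_hasKind_lin B _ h.hole)
  | @prod m A B hA hB ihA ihB =>
    intro Δ h
    have hA := ty_hasKind_lin A Δ h
    -- The first component contributes its kind `m`, yet it is dropped from the environment of the
    -- second at kind `lin`.
    simpa only [ty] using .sigma (ihA h) (h.condExt_lin hA) (ihB h.hole)
  | ses S => intro Δ h; exact ty_hasKind_lin _ _ h
  | sub _ hle ih => intro Δ h; exact .sub (ih h) hle

-- Subtyping and conversion of translated types

theorem casSes_sub {Δ : Env} (h : Unrestricted Δ) {V : Tm} {K L L' : LabelSet}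
    {S : L.Mem → LSST.Ses} {S' : L'.Mem → LSST.Ses} (hv : V.isVal = true)
    (hK : K.1 = L.1 ∩ L'.1) (hV : Typing Δ V (.lab K))
    (ih : ∀ (l : Label) (hl : l ∈ L.1) (hl' : l ∈ L'.1) (Δ : Env), Unrestricted Δ →
      Sub Δ (ses (S ⟨l, hl⟩)) (ses (S' ⟨l, hl'⟩)) .lin) :
    Sub Δ (casSes V L S) (casSes V L' S') .lin :=
  .cas hv hK hV fun l hl hl' => by
    rw [ses_shift, ses_shift]
    have hl'' : l ∈ K.1 := by rw [hK]; exact Finset.mem_inter.2 ⟨hl, hl'⟩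
    exact ih l hl hl' _ (h.cons (.eqT_lbl h.form hv hV ⟨l, hl''⟩))

/-- Kind `lin` suffices throughout, since subsumption in the target accepts any kind. -/
theorem ty_sub_ty {A B : LSST.Ty} (hAB : LSST.Sub A B) :
    ∀ (Δ : Env), Unrestricted Δ → Sub Δ (ty A) (ty B) .lin := by
  induction hAB with
  | unit => intro Δ h; exact .conv (.refl (ty_hasKind_lin _ _ h))
  | endS => intro Δ h; exact .conv (.refl (ty_hasKind_lin _ _ h))
  | endR => intro Δ h; exact .conv (.refl (ty_hasKind_lin _ _ h))
  | @arr A A' B B' m n _ _ hmn ihA ihB =>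
    intro Δ h
    have := LDGV.Sub.pi (ihA Δ h) (h.condExt_lin (ty_hasKind_lin A' _ h)) (ihB _ h.hole) hmn
    simpa only [ty] using LDGV.Sub.sub this n.le_lin
  | @prod A A' B B' _ _ ihA ihB =>
    intro Δ h
    simpa only [ty] using
      LDGV.Sub.sigma (ihA Δ h) (h.condExt_lin (ty_hasKind_lin A _ h)) (ihB _ h.hole)
  | @send A A' S S' _ _ ihA ihS =>
    intro Δ h
    have hS := ihS _ h.hole
    simp only [ty, ses] at hS ⊢
    exact .out (ihA Δ h) (h.condExt_lin (ty_hasKind_lin A' _ h)) (ses_isSes S) (ses_isSes S') hS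
  | @recv A A' S S' _ _ ihA ihS =>
    intro Δ h
    have hS := ihS _ h.hole
    simp only [ty, ses] at hS ⊢
    exact .inn (ihA Δ h) (h.condExt_lin (ty_hasKind_lin A _ h)) (ses_isSes S) (ses_isSes S') hS
  | @choice L L' S S' hL _ ih =>
    intro Δ h
    simp only [ty, ses] at ih ⊢
    exact .out (.lab h.form hL) (h.condExt_lab L') (.cas fun l => ses_isSes (S l))
      (.cas fun l => ses_isSes (S' l))
      -- The bound label ranges over the payload of the supertype, `L'`, which is also the
      -- intersection because `L' ⊆ L`.
      (casSes_sub (h.lab L') rfl (Finset.inter_eq_right.2 hL).symm (typing_lab_zero h L')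
        fun l _ hl' => ih ⟨l, hl'⟩)
  | @branch L L' S S' hL _ ih =>
    intro Δ h
    simp only [ty, ses] at ih ⊢
    exact .inn (.lab h.form hL) (h.condExt_lab L) (.cas fun l => ses_isSes (S l))
      (.cas fun l => ses_isSes (S' l))
      -- Dually, a received label ranges over the payload of the subtype, and `L ∩ L' = L`.
      (casSes_sub (h.lab L) rfl (Finset.inter_eq_left.2 hL).symm (typing_lab_zero h L)
        fun l hl _ => ih ⟨l, hl⟩)

theorem casSes_lbl_sub {Δ : Env} (h : Unrestricted Δ) {L : LabelSet} (S : L.Mem → LSST.Ses)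
    (l : L.Mem) : Sub Δ (casSes (.lbl l.1) L S) (ses (S l)) .lin :=
  .conv (.beta (A := fun l => ses (S l)) l fun k => ses_hasKind (S k) Δ h)

/-- In presence of an equation `V = l`, the type `case V of {l : ⟦S_l⟧}` converts to `⟦S_l⟧`. -/
theorem casSes_sub_of_eq {Δ : Env} (h : Unrestricted Δ) {L : LabelSet} (S : L.Mem → LSST.Ses)
    (l : L.Mem) {U V : Tm} (hv : U.isVal = true) (hU : Typing Δ U (.eqT L V (.lbl l.1))) :
    Sub Δ (casSes V L S) (ses (S l)) .lin := by
  -- The case type is taken with its scrutinee as a free name, the form on which conversion by an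
  -- equation acts; instantiating at `V` and at `l` gives the two sides, and reducing the case on a
  -- label finishes.
  have hk := casSes_hasKind (h.lab L) S (V := .name 0) rfl (typing_lab_zero h L)
  have hc := Conv.subst hk hv hU
  rw [casSes_inst, casSes_inst] at hc
  exact .trans (.conv hc) (casSes_lbl_sub h S l)

/-! ## Realizations of source environments -/

/-- The renaming that makes room for the label bound by a `let` and for an equation about it,
where the channel bound by the same `let` comes between the two. -/
def branchRen (r : ℕ → ℕ) : ℕ → ℕ
  | 0 => 1
  | i + 1 => r i + 3

/-- `Realizes Δ r Γ Γ'`: every binding of the source environment `Γ` is found in the target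
environment `Γ'`, at the index given by `r`, either with its translated type or, in the branch `l`
of a case distinction on a label, with a type that converts to it by the equation of this branch.
The further bindings of `Γ'` are labels and such equations; they form `Δ`. -/
inductive Realizes : Env → (ℕ → ℕ) → LSST.Env → Env → Prop
  | nil (r : ℕ → ℕ) : Realizes [] r [] []
  | hole {Δ Γ' : Env} {r : ℕ → ℕ} {Γ : LSST.Env} : Realizes Δ r Γ Γ' →
      Realizes (none :: Δ) (upRen r) (none :: Γ) (none :: Γ')
  | bind {Δ Γ' : Env} {r : ℕ → ℕ} {Γ : LSST.Env} (A : LSST.Ty) : Realizes Δ r Γ Γ' →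
      Realizes (none :: Δ) (upRen r) (some A :: Γ) (some (ty A) :: Γ')
  | skip {Δ Γ' : Env} {r : ℕ → ℕ} {Γ : LSST.Env} : Realizes Δ r Γ Γ' →
      Realizes (none :: Δ) (Nat.succ ∘ r) Γ (none :: Γ')
  | branchHole {Δ Γ' : Env} {r : ℕ → ℕ} {Γ : LSST.Env} (L : LabelSet) (l : L.Mem) :
      Realizes Δ r Γ Γ' →
      Realizes (some (.eqT L (.name 1) (.lbl l.1)) :: none :: some (.lab L) :: Δ) (branchRen r)
        (none :: Γ) (some (.eqT L (.name 1) (.lbl l.1)) :: none :: some (.lab L) :: Γ')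
  | branch {Δ Γ' : Env} {r : ℕ → ℕ} {Γ : LSST.Env} (L : LabelSet) (S : L.Mem → LSST.Ses)
      (l : L.Mem) : Realizes Δ r Γ Γ' →
      Realizes (some (.eqT L (.name 1) (.lbl l.1)) :: none :: some (.lab L) :: Δ) (branchRen r)
        (some (.ses (S l)) :: Γ)
        (some (.eqT L (.name 1) (.lbl l.1)) :: some (casSes (.name 0) L S) ::
          some (.lab L) :: Γ')

theorem typing_lab_one {Δ : Env} (h : Unrestricted Δ) (L : LabelSet) :
    Typing (none :: some (.lab L) :: Δ) (.name 1) (.lab L) :=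
  (HasVar.there none .here).typing (h.lab L).hole.form

theorem hasKind_branch_eq {Δ : Env} (h : Unrestricted Δ) (L : LabelSet) (l : L.Mem) :
    HasKind (none :: some (.lab L) :: Δ) (.eqT L (.name 1) (.lbl l.1)) .un :=
  .eqT_lbl (h.lab L).hole.form rfl (typing_lab_one h L) l

theorem unr_lab {Γ Δ : Env} (hu : Unr Γ Δ) (h : Unrestricted Δ) (L : LabelSet) :
    Unr (some (.lab L) :: Γ) (some (.lab L) :: Δ) :=
  .cons hu (h.condExt_lab L)

theorem unr_drop {Γ Δ : Env} {A : Ty} (hu : Unr Γ Δ) (h : Unrestricted Δ)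
    (hA : HasKind Δ A .lin) : Unr (some A :: Γ) (none :: Δ) :=
  .cons hu (h.condExt_lin hA)

theorem casSes_hasKind_zero {Δ : Env} (h : Unrestricted Δ) (L : LabelSet)
    (S : L.Mem → LSST.Ses) : HasKind (some (.lab L) :: Δ) (casSes (.name 0) L S) .lin :=
  casSes_hasKind (h.lab L) S rfl (typing_lab_zero h L)

namespace Realizes

variable {Δ Γ' : Env} {r : ℕ → ℕ} {Γ : LSST.Env}

theorem unrestricted (h : Realizes Δ r Γ Γ') : Unrestricted Δ := by
  induction h with
  | nil => exact .nil
  | hole _ ih => exact ih.hole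
  | bind _ _ ih => exact ih.hole
  | skip _ ih => exact ih.hole
  | branchHole L l _ ih => exact (ih.lab L).hole.cons (hasKind_branch_eq ih L l)
  | branch L S l _ ih => exact (ih.lab L).hole.cons (hasKind_branch_eq ih L l)

/-- Every source binding is discarded at kind `lin`, so the unrestricted part does not depend on
which source bindings are present. This is why both halves of a split can share `Δ`. -/
theorem unr (h : Realizes Δ r Γ Γ') : Unr Γ' Δ := by
  induction h with
  | nil => exact .nil
  | hole _ ih => exact .hole ih
  | bind A h ih => exact unr_drop ih h.unrestricted (ty_hasKind_lin A _ h.unrestricted)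
  | skip _ ih => exact .hole ih
  | branchHole L l h ih =>
    have hΔ := h.unrestricted
    exact .cons (.hole (unr_lab ih hΔ L))
      (.un (hΔ.lab L).hole.unr (hasKind_branch_eq hΔ L l))
  | branch L S l h ih =>
    have hΔ := h.unrestricted
    exact .cons (unr_drop (unr_lab ih hΔ L) (hΔ.lab L) (casSes_hasKind_zero hΔ L S))
      (.un (hΔ.lab L).hole.unr (hasKind_branch_eq hΔ L l))

/-- The part of a split that consists of the labels and equations only. -/
theorem split_left (h : Realizes Δ r Γ Γ') : Split Γ' Δ Γ' := by
  induction h with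
  | nil => exact .nil
  | hole _ ih => exact .hole ih
  | bind A h ih => exact .right ih h.unr (ty_hasKind_lin A _ h.unrestricted)
  | skip _ ih => exact .hole ih
  | branchHole L l h ih =>
    have hΔ := h.unrestricted
    have hl := HasKind.lab (L := L) hΔ.form
    have he := hasKind_branch_eq hΔ L l
    exact .both (.hole (.both ih hΔ.unr hl h.unr hl)) (hΔ.lab L).hole.unr he
      (.hole (unr_lab h.unr hΔ L)) he
  | branch L S l h ih =>
    have hΔ := h.unrestricted
    have hl := HasKind.lab (L := L) hΔ.form
    have he := hasKind_branch_eq hΔ L l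
    have hc := casSes_hasKind_zero hΔ L S
    exact .both (.right (.both ih hΔ.unr hl h.unr hl) (unr_lab h.unr hΔ L) hc)
      (hΔ.lab L).hole.unr he (unr_drop (unr_lab h.unr hΔ L) (hΔ.lab L) hc) he

end Realizes

theorem Split.symm : ∀ {Γ Γ₁ Γ₂ : Env}, Split Γ Γ₁ Γ₂ → Split Γ Γ₂ Γ₁
  | _, _, _, .nil => .nil
  | _, _, _, .hole h => .hole (Split.symm h)
  | _, _, _, .both h hu₁ hk₁ hu₂ hk₂ => .both (Split.symm h) hu₂ hk₂ hu₁ hk₁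
  | _, _, _, .left h hu hk => .right (Split.symm h) hu hk
  | _, _, _, .right h hu hk => .left (Split.symm h) hu hk

namespace Realizes

variable {Δ Γ' : Env} {r : ℕ → ℕ} {Γ : LSST.Env}

theorem split_right (h : Realizes Δ r Γ Γ') : Split Γ' Γ' Δ :=
  Split.symm h.split_left

/-- Source bindings follow the source split, while labels and equations are copied to both sides.
The half that loses a case-typed channel keeps its label and equation, which is what `branchHole`
describes. -/
theorem split (h : Realizes Δ r Γ Γ') : ∀ {Γ₁ Γ₂ : LSST.Env}, LSST.Split Γ Γ₁ Γ₂ →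
    ∃ Γ₁' Γ₂', Split Γ' Γ₁' Γ₂' ∧ Realizes Δ r Γ₁ Γ₁' ∧ Realizes Δ r Γ₂ Γ₂' := by
  induction h with
  | nil r =>
    intro Γ₁ Γ₂ hs
    cases hs
    exact ⟨[], [], .nil, .nil r, .nil r⟩
  | hole _ ih =>
    intro Γ₁ Γ₂ hs
    cases hs with
    | hole hs =>
      obtain ⟨Γ₁', Γ₂', hs', h₁, h₂⟩ := ih hs
      exact ⟨_, _, .hole hs', h₁.hole, h₂.hole⟩
  | bind A h ih =>
    intro Γ₁ Γ₂ hs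
    have hΔ := h.unrestricted
    cases hs with
    | both hs hA =>
      obtain ⟨Γ₁', Γ₂', hs', h₁, h₂⟩ := ih hs
      exact ⟨_, _, .both hs' h₁.unr (ty_hasKind hA hΔ) h₂.unr (ty_hasKind hA hΔ), h₁.bind A,
        h₂.bind A⟩
    | left hs hA =>
      obtain ⟨Γ₁', Γ₂', hs', h₁, h₂⟩ := ih hs
      exact ⟨_, _, .left hs' h₁.unr (ty_hasKind hA hΔ), h₁.bind A, h₂.hole⟩
    | right hs hA =>
      obtain ⟨Γ₁', Γ₂', hs', h₁, h₂⟩ := ih hs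
      exact ⟨_, _, .right hs' h₂.unr (ty_hasKind hA hΔ), h₁.hole, h₂.bind A⟩
  | skip _ ih =>
    intro Γ₁ Γ₂ hs
    obtain ⟨Γ₁', Γ₂', hs', h₁, h₂⟩ := ih hs
    exact ⟨_, _, .hole hs', h₁.skip, h₂.skip⟩
  | branchHole L l h ih =>
    intro Γ₁ Γ₂ hs
    have hΔ := h.unrestricted
    have hl := HasKind.lab (L := L) hΔ.form
    have he := hasKind_branch_eq hΔ L l
    cases hs with
    | hole hs =>
      obtain ⟨Γ₁', Γ₂', hs', h₁, h₂⟩ := ih hs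
      have h₁' := h₁.branchHole L l
      have h₂' := h₂.branchHole L l
      exact ⟨_, _, .both (.hole (.both hs' h₁.unr hl h₂.unr hl)) (.hole (unr_lab h₁.unr hΔ L)) he
        (.hole (unr_lab h₂.unr hΔ L)) he, h₁', h₂'⟩
  | branch L S l h ih =>
    intro Γ₁ Γ₂ hs
    have hΔ := h.unrestricted
    have hl := HasKind.lab (L := L) hΔ.form
    have he := hasKind_branch_eq hΔ L l
    have hc := casSes_hasKind_zero hΔ L S
    cases hs with
    -- A channel is never unrestricted, so it cannot be copied.
    | both hs hA => exact hA.ses_un_elim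
    | left hs hA =>
      obtain ⟨Γ₁', Γ₂', hs', h₁, h₂⟩ := ih hs
      exact ⟨_, _, .both (.left (.both hs' h₁.unr hl h₂.unr hl) (unr_lab h₁.unr hΔ L) hc)
        (unr_drop (unr_lab h₁.unr hΔ L) (hΔ.lab L) hc) he (.hole (unr_lab h₂.unr hΔ L)) he,
        h₁.branch L S l, h₂.branchHole L l⟩
    | right hs hA =>
      obtain ⟨Γ₁', Γ₂', hs', h₁, h₂⟩ := ih hs
      exact ⟨_, _, .both (.right (.both hs' h₁.unr hl h₂.unr hl) (unr_lab h₂.unr hΔ L) hc)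
        (.hole (unr_lab h₁.unr hΔ L)) he (unr_drop (unr_lab h₂.unr hΔ L) (hΔ.lab L) hc) he,
        h₁.branchHole L l, h₂.branch L S l⟩

theorem form {m : Mult} (h : Realizes Δ r Γ Γ') : LSST.EnvForm m Γ → EnvForm m Γ' := by
  have raise : ∀ {Δ : Env} {A : Ty}, HasKind Δ A .un → HasKind Δ A m := fun hA => by
    cases m
    exacts [.sub hA .un_lin, hA]
  induction h with
  | nil => intro; exact .nil
  | hole _ ih =>
    intro hΓ
    cases hΓ with
    | hole hΓ => exact .hole (ih hΓ)
  | bind A h ih =>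
    intro hΓ
    cases hΓ with
    | cons hΓ hA => exact .cons (ih hΓ) h.unr (ty_hasKind hA h.unrestricted)
  | skip _ ih => intro hΓ; exact .hole (ih hΓ)
  | branchHole L l h ih =>
    intro hΓ
    have hΔ := h.unrestricted
    cases hΓ with
    | hole hΓ =>
      exact .cons (.hole (.cons (ih hΓ) h.unr (raise (.lab hΔ.form))))
        (.hole (unr_lab h.unr hΔ L)) (raise (hasKind_branch_eq hΔ L l))
  | branch L S l h ih =>
    intro hΓ
    have hΔ := h.unrestricted
    have hc := casSes_hasKind_zero hΔ L S
    cases hΓ with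
    | cons hΓ hA =>
      cases m with
      | un => exact hA.ses_un_elim
      | lin =>
        exact .cons (.cons (.cons (ih hΓ) h.unr (raise (.lab hΔ.form))) (unr_lab h.unr hΔ L) hc)
          (unr_drop (unr_lab h.unr hΔ L) (hΔ.lab L) hc) (raise (hasKind_branch_eq hΔ L l))

/-- Stronger than formation at kind `un`: `new` forms its session type in the whole environment, and
`ses_hasKind` asks that this environment be its own unrestricted part. -/
theorem unrestricted_of_un (h : Realizes Δ r Γ Γ') :
    LSST.EnvForm .un Γ → Unrestricted Γ' := by
  induction h with
  | nil => intro; exact .nil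
  | hole _ ih =>
    intro hΓ
    cases hΓ with
    | hole hΓ => exact (ih hΓ).hole
  | bind A h ih =>
    intro hΓ
    cases hΓ with
    | cons hΓ hA => exact (ih hΓ).cons (ty_hasKind hA (ih hΓ))
  | skip _ ih => intro hΓ; exact (ih hΓ).hole
  | branchHole L l h ih =>
    intro hΓ
    cases hΓ with
    | hole hΓ => exact ((ih hΓ).lab L).hole.cons (hasKind_branch_eq (ih hΓ) L l)
  | branch L S l h ih =>
    intro hΓ
    cases hΓ with
    | cons hΓ hA => exact hA.ses_un_elim

end Realizes

-- Looking up names in a realization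

/-- `T` is the translation of `A`, or converts to it by an equation in `Δ`. -/
def ConvertsTo (Δ : Env) (T : Ty) (A : LSST.Ty) : Prop :=
  T = ty A ∨ ∃ (L : LabelSet) (S : L.Mem → LSST.Ses) (l : L.Mem) (i j : ℕ),
    T = casSes (.name j) L S ∧ A = .ses (S l) ∧ HasVar Δ i (.eqT L (.name j) (.lbl l.1))

theorem ConvertsTo.shift {Δ : Env} {T : Ty} {A : LSST.Ty} (h : ConvertsTo Δ T A)
    (o : Option Ty) : ConvertsTo (o :: Δ) (T.shift 1) A := by
  obtain rfl | ⟨L, S, l, i, j, rfl, rfl, hv⟩ := h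
  · exact .inl (ty_shift _ _)
  · refine .inr ⟨L, S, l, i + 1, j + 1, casSes_shift _ _ _ _, rfl, ?_⟩
    simpa only [Ty.shift, Ty.ren, Tm.ren] using hv.there o

theorem ConvertsTo.sub {Δ : Env} {T : Ty} {A : LSST.Ty} (h : ConvertsTo Δ T A)
    (hΔ : Unrestricted Δ) : LDGV.Sub Δ T (ty A) .lin := by
  obtain rfl | ⟨L, S, l, i, j, rfl, rfl, hv⟩ := h
  · exact .conv (.refl (ty_hasKind_lin A Δ hΔ))
  · exact casSes_sub_of_eq hΔ S l rfl (hv.typing hΔ.form)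

namespace Realizes

variable {Δ Γ' : Env} {r : ℕ → ℕ} {Γ : LSST.Env}

/-- Erasing the binding on both sides leaves a realization, so `form` yields the unrestrictedness of
the remaining bindings that the name rule demands. The equation is sought in `Δ`, since subsumption
works over the unrestricted part. -/
theorem lookup (h : Realizes Δ r Γ Γ') : ∀ {Γ₁ Γ₂ : LSST.Env} {A : LSST.Ty},
    Γ = Γ₂ ++ some A :: Γ₁ → ∃ (Γ₁' Γ₂' : Env) (T : Ty), Γ' = Γ₂' ++ some T :: Γ₁' ∧
      r Γ₂.length = Γ₂'.length ∧ CondExt Γ₁' T (none :: Γ₁') ∧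
      Realizes Δ r (Γ₂ ++ none :: Γ₁) (Γ₂' ++ none :: Γ₁') ∧
      ConvertsTo Δ (T.shift (Γ₂'.length + 1)) A := by
  induction h with
  | nil => intro Γ₁ Γ₂ A he; simp at he
  | hole _ ih =>
    intro Γ₁ Γ₂ A he
    cases Γ₂ with
    | nil => simp at he
    | cons o Γ₂ =>
      obtain ⟨rfl, ht⟩ := List.cons.inj he
      obtain ⟨Γ₁', Γ₂', T, rfl, hr, hc, hR, hT⟩ := ih ht
      exact ⟨Γ₁', none :: Γ₂', T, rfl, by simpa [upRen] using hr, hc, hR.hole,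
        by simpa only [Ty.shift_shift, List.length_cons] using hT.shift none⟩
  | bind B h ih =>
    intro Γ₁ Γ₂ A he
    cases Γ₂ with
    | nil =>
      simp only [List.nil_append, List.cons.injEq, Option.some.injEq] at he
      obtain ⟨rfl, rfl⟩ := he
      exact ⟨_, [], ty B, rfl, rfl, .lin h.unr (ty_hasKind_lin B _ h.unrestricted), h.hole,
        .inl (ty_shift _ _)⟩
    | cons o Γ₂ =>
      obtain ⟨rfl, ht⟩ := List.cons.inj he
      obtain ⟨Γ₁', Γ₂', T, rfl, hr, hc, hR, hT⟩ := ih ht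
      exact ⟨Γ₁', some (ty B) :: Γ₂', T, rfl, by simpa [upRen] using hr, hc, hR.bind B,
        by simpa only [Ty.shift_shift, List.length_cons] using hT.shift none⟩
  | skip _ ih =>
    intro Γ₁ Γ₂ A he
    obtain ⟨Γ₁', Γ₂', T, rfl, hr, hc, hR, hT⟩ := ih he
    exact ⟨Γ₁', none :: Γ₂', T, rfl, by simpa using hr, hc, hR.skip,
      by simpa only [Ty.shift_shift, List.length_cons] using hT.shift none⟩
  | branchHole L l _ ih =>
    intro Γ₁ Γ₂ A he
    cases Γ₂ with
    | nil => simp at he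
    | cons o Γ₂ =>
      obtain ⟨rfl, ht⟩ := List.cons.inj he
      obtain ⟨Γ₁', Γ₂', T, rfl, hr, hc, hR, hT⟩ := ih ht
      exact ⟨Γ₁', some (.eqT L (.name 1) (.lbl l.1)) :: none :: some (.lab L) :: Γ₂', T, rfl,
        by simpa [branchRen] using hr, hc, hR.branchHole L l,
        by simpa only [Ty.shift_shift, List.length_cons] using ((hT.shift _).shift _).shift _⟩
  | branch L S l h ih =>
    intro Γ₁ Γ₂ A he
    have hΔ := h.unrestricted
    cases Γ₂ with
    | nil =>
      simp only [List.nil_append, List.cons.injEq, Option.some.injEq] at he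
      obtain ⟨rfl, rfl⟩ := he
      -- Seen from the whole environment, the equation has index `0`, the channel `1` and the label
      -- `2`; hence the witnesses `0` and `2`.
      refine ⟨_, [some (.eqT L (.name 1) (.lbl l.1))], casSes (.name 0) L S, rfl, rfl,
        .lin (unr_lab h.unr hΔ L) (casSes_hasKind_zero hΔ L S), h.branchHole L l,
        .inr ⟨L, S, l, 0, 2, casSes_shift _ _ _ _, rfl, .here⟩⟩
    | cons o Γ₂ =>
      obtain ⟨rfl, ht⟩ := List.cons.inj he
      obtain ⟨Γ₁', Γ₂', T, rfl, hr, hc, hR, hT⟩ := ih ht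
      exact ⟨Γ₁', some (.eqT L (.name 1) (.lbl l.1)) :: some (casSes (.name 0) L S) ::
        some (.lab L) :: Γ₂', T, rfl,
        by simpa [branchRen] using hr, hc, hR.branch L S l,
        by simpa only [Ty.shift_shift, List.length_cons] using ((hT.shift _).shift _).shift _⟩

theorem id_env : ∀ Γ : LSST.Env, ∃ Δ, Realizes Δ id Γ (env Γ)
  | [] => ⟨[], .nil id⟩
  | none :: Γ => by
    obtain ⟨Δ, h⟩ := id_env Γ
    exact ⟨_, upRen_id ▸ h.hole⟩
  | some A :: Γ => by
    obtain ⟨Δ, h⟩ := id_env Γ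
    exact ⟨_, upRen_id ▸ h.bind A⟩

end Realizes

/-! ## Typing preservation -/

section

variable {Δ Γ' : Env} {r : ℕ → ℕ} {Γ : LSST.Env}

/-- The name rule gives the type stored in the target environment; subsumption then turns a case
type into the expected session type. -/
theorem Realizes.typing_name {Γ₁ Γ₂ : LSST.Env} {A : LSST.Ty}
    (h : Realizes Δ r (Γ₂ ++ some A :: Γ₁) Γ')
    (h₁ : LSST.EnvForm .un Γ₁) (h₂ : LSST.EnvForm .un Γ₂) :
    Typing Γ' (.name (r Γ₂.length)) (ty A) := by
  obtain ⟨Γ₁', Γ₂', T, rfl, hr, hc, hR, hT⟩ := h.lookup rfl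
  have hform : LSST.EnvForm .un (Γ₂ ++ none :: Γ₁) := by
    clear h hR hr
    induction h₂ with
    | nil => exact .hole h₁
    | hole _ ih => exact .hole ih
    | cons _ hA ih => exact .cons ih hA
  rw [hr]
  exact .sub (.name hc (hR.form hform)) h.unr (hT.sub h.unrestricted)

theorem typing_pair (h : Realizes Δ r Γ Γ') {Γ₁' Γ₂' : Env} (hs : Split Γ' Γ₁' Γ₂')
    (hu₂ : Unr Γ₂' Δ) {A B : LSST.Ty} {V N : Tm} (hv : V.isVal = true)
    (hV : Typing Γ₁' V (ty A)) (hN : Typing (none :: Γ₂') N (ty B)) :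
    Typing Γ' (.pair (ty A) V N) (.sigma (ty A) (ty B)) := by
  have hΔ := h.unrestricted
  exact .pair hs h.unr (ty_hasKind_lin (.prod A B) Δ hΔ) hv hV
    (.lin hu₂ (ty_hasKind_lin A Δ hΔ)) hN

/-- Renaming preserves and reflects being a value, so it does not change which of the two forms of a
pair is chosen. -/
theorem pair_ren (A : Ty) (hA : ∀ r, A.ren r = A) (M N : Tm) (r : ℕ → ℕ) :
    (pair A M N).ren r = pair A (M.ren r) (N.ren r) := by
  unfold pair
  rw [Tm.isVal_ren]
  split
  · simp only [Tm.ren, hA, Tm.shift, Tm.ren_ren]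
    rfl
  · simp only [Tm.ren, hA, Tm.shift, Tm.ren_ren, upRen]
    rfl

theorem typing_select (h : Realizes Δ r Γ Γ') (hΓ : LSST.EnvForm .un Γ) (L : LabelSet)
    (S : L.Mem → LSST.Ses) (l : L.Mem) :
    Typing Γ' (.lam .lin (ses (.choice L S)) (.app (.send (.name 0)) (.lbl l.1)))
      (.pi .lin (ses (.choice L S)) (ses (S l))) := by
  have hΔ := h.unrestricted
  have hΓ' := h.unrestricted_of_un hΓ
  have hc := ses_hasKind (.choice L S) Δ hΔ
  have hx : Typing (some (ses (.choice L S)) :: Δ) (.name 0) (ses (.choice L S)) := by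
    simpa only [ses_shift] using Typing.name_zero hΔ.form hΔ.unr hc
  have hk : HasKind (none :: Δ) ((casSes (.name 0) L S).inst (.lbl l.1)) .lin := by
    rw [casSes_inst]
    exact casSes_hasKind hΔ.hole S rfl (.of_mem hΔ.hole.form l)
  have hu := unr_drop h.unr hΔ hc
  refine .lam hΓ'.form.lin_of_un (.sub (A := casSes (.lbl l.1) L S) ?_ hu
    (casSes_lbl_sub hΔ.hole S l))
  rw [← casSes_inst]
  simp only [ses] at hx hu ⊢
  -- The channel goes to the function and `Γ'` to the label argument, where nothing is lost because
  -- `Γ'` is unrestricted; `Δ` is on both sides.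
  exact .app (.left h.split_left hΔ.unr (by simpa only [ses] using hc)) (.send hx)
    (.of_mem hΓ'.hole.form l) hu hk

/-- Dropping the exhausted channel is legitimate because `End` has kind `un`. All of `Γ'` goes to
`M`; the label and the discarding function are typed in `Δ`. -/
theorem typing_close (h : Realizes Δ r Γ Γ') {M : Tm} (hM : Typing Γ' M (ses .endS)) :
    Typing Γ' (.app (.lam .lin .endT .unit) (.app (.send M) (.lbl eos))) .unit := by
  have hΔ := h.unrestricted
  have hsend : Typing Γ' (.app (.send M) (.lbl eos)) .endT := by
    simp only [ses] at hM
    exact .app (B := .endT) h.split_right (.send hM)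
      (.of_mem hΔ.form (⟨eos, Finset.mem_singleton_self eos⟩ : eosSet.Mem)) h.unr (.endT hΔ.form)
  exact .app (B := .unit) h.split_left
    (.lam hΔ.form.lin_of_un (.unit (hΔ.cons (.endT hΔ.form)).form)) hsend h.unr (.unit hΔ.form)

theorem typing_wait (h : Realizes Δ r Γ Γ') {M : Tm} (hM : Typing Γ' M (ses .endR)) :
    Typing Γ' (.letp (.recv M) .unit) .unit := by
  have hΔ := h.unrestricted
  have hL := hΔ.lab eosSet
  simp only [ses] at hM
  exact .letp h.split_right (.recv hM) (.unit (hL.cons (.endT hL.form)).form) h.unr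
    (.unit hΔ.form)

/-- The plain `let` rule is enough: the case distinction is already part of the translated body. -/
theorem typing_rcase (h : Realizes Δ r Γ Γ') {Γ₁' Γ₂' : Env} (hs : Split Γ' Γ₁' Γ₂')
    (hu₂ : Unr Γ₂' Δ) {L : LabelSet} {S : L.Mem → LSST.Ses} {A : LSST.Ty} {M : Tm}
    {N : L.Mem → Tm} (hM : Typing Γ₁' M (ses (.branch L S)))
    (hN : ∀ l, Typing (some (.eqT L (.name 1) (.lbl l.1)) :: some (casSes (.name 0) L S) ::
      some (.lab L) :: Γ₂') ((N l).shift 1) (ty A)) :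
    Typing Γ' (.letp (.recv M) (.cas (.name 1) L N)) (ty A) := by
  have hΔ := h.unrestricted
  simp only [ses] at hM
  refine .letp hs (.recv hM) ?_ h.unr (ty_hasKind_lin A Δ hΔ)
  -- The unrestricted part loses the channel and keeps the label, so the scrutinee is still typable.
  refine .cas rfl (unr_drop (unr_lab hu₂ hΔ L) (hΔ.lab L) (casSes_hasKind_zero hΔ L S))
    (typing_lab_one hΔ L) fun l => ?_
  rw [ty_shift, ty_shift]
  exact hN l

end

theorem tm_typing {Γ : LSST.Env} {M : LSST.Tm} {A : LSST.Ty} (d : LSST.Typing Γ M A) :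
    ∀ {Δ Γ' : Env} {r : ℕ → ℕ}, Realizes Δ r Γ Γ' → Typing Γ' ((tm d).ren r) (ty A) := by
  induction d with
  | name Γ₁ Γ₂ A h₁ h₂ =>
    intro Δ Γ' r h
    simpa only [tm, Tm.ren] using h.typing_name h₁ h₂
  | sub d hAB ih =>
    intro Δ Γ' r h
    simpa only [tm] using .sub (ih h) h.unr (ty_sub_ty hAB Δ h.unrestricted)
  | unit hΓ =>
    intro Δ Γ' r h
    simpa only [tm, Tm.ren, ty] using .unit (h.form hΓ)
  | lam A B hΓ d ih =>
    intro Δ Γ' r h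
    simpa only [tm, Tm.ren, ty, ty_ren] using .lam (h.form hΓ) (ih (h.bind A))
  | @app _ _ _ _ _ _ A B hs d e ihd ihe =>
    intro Δ Γ' r h
    obtain ⟨Γ₁', Γ₂', hs', h₁, h₂⟩ := h.split hs
    have hd := ihd h₁
    simp only [tm, Tm.ren, ty] at hd ⊢
    -- The codomain is closed, so the substitution of the argument into it is vacuous.
    have := Typing.app (n := .lin) hs' hd (ihe h₂) h.unr
      (by rw [ty_inst]; exact ty_hasKind_lin B Δ h.unrestricted)
    simpa only [ty_inst] using this
  | @pair _ _ _ M N A B hs d e ihd ihe =>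
    intro Δ Γ' r h
    obtain ⟨Γ₁', Γ₂', hs', h₁, h₂⟩ := h.split hs
    have hΔ := h.unrestricted
    have hA := ty_hasKind_lin A Δ hΔ
    simp only [tm, ty]
    rw [pair_ren _ (fun r => ty_ren r A)]
    unfold pair
    split
    · next hv =>
      refine typing_pair h hs' h₂.unr hv (ihd h₁) ?_
      -- The name bound by the target pair has no source counterpart; `skip` accounts for its slot.
      simpa only [Tm.shift, Tm.ren_ren] using ihe h₂.skip
    · have hfun : Typing Γ₂' (.lam .lin (ty A) (.pair (ty A) (.name 0) (((tm e).ren r).shift 2)))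
          (.pi .lin (ty A) (.sigma (ty A) (ty B))) := by
        refine .lam (h₂.form (LSST.Env.form_lin _)) ?_
        -- Inside the function only its parameter is given to the first component; `Γ₂'` goes to the
        -- second, under two skipped names.
        refine typing_pair (h₂.bind A) (.left h₂.split_left hΔ.unr hA) (.hole h₂.unr) rfl ?_ ?_
        · simpa only [ty_shift] using Typing.name_zero hΔ.form hΔ.unr hA
        · simp only [Tm.shift, Tm.ren_ren]
          exact ihe h₂.skip.skip
      have hk := ty_hasKind_lin (.prod A B) Δ hΔ
      -- The function encloses the second component and the argument is the first, so the split is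
      -- used in reverse.
      have := Typing.app (n := .lin) (Split.symm hs') hfun (ihd h₁) h.unr
        (by simpa only [ty, ty_inst] using (ty_inst (.prod A B) _).symm ▸ hk)
      simpa only [Ty.inst, Ty.sub, ty_sub] using this
  | @letp _ _ _ _ _ A B C hs d e ihd ihe =>
    intro Δ Γ' r h
    obtain ⟨Γ₁', Γ₂', hs', h₁, h₂⟩ := h.split hs
    have hd := ihd h₁
    simp only [tm, Tm.ren, ty] at hd ⊢
    exact .letp hs' hd (by simpa only [ty_shift] using ihe ((h₂.bind A).bind B)) h.unr
      (ty_hasKind_lin C Δ h.unrestricted)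
  | fork d ih =>
    intro Δ Γ' r h
    have hd := ih h
    simp only [tm, Tm.ren, ty] at hd ⊢
    exact .fork hd
  | new S hΓ =>
    intro Δ Γ' r h
    have := Typing.new (ses_isSes S) (ses_hasKind S Γ' (h.unrestricted_of_un hΓ))
    simpa only [tm, Tm.ren, ty, ← ses_dual, ses_shift] using this
  | send d ih =>
    intro Δ Γ' r h
    have hd := ih h
    simp only [tm, Tm.ren, ty, ses] at hd ⊢
    exact .send hd
  | recv d ih =>
    intro Δ Γ' r h
    have hd := ih h
    simp only [tm, Tm.ren, ty, ses] at hd ⊢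
    exact .recv hd
  | select L S l hΓ =>
    intro Δ Γ' r h
    simpa only [tm, Tm.ren, ty, ses_ren, upRen] using typing_select h hΓ L S l
  | @rcase _ _ _ _ A L S N hs d e ihd ihe =>
    intro Δ Γ' r h
    obtain ⟨Γ₁', Γ₂', hs', h₁, h₂⟩ := h.split hs
    have hd := ihd h₁
    simp only [tm, Tm.ren, ty] at hd ⊢
    refine typing_rcase h hs' h₂.unr hd fun l => ?_
    -- From right to left: room for the label in the translated branch, the renaming under the two
    -- names of the `let`, and the shift past the equation.
    have hren : (fun i => i + 1) ∘ upRen (upRen r) ∘ upRen Nat.succ = branchRen r := by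
      funext i
      cases i <;> rfl
    simpa only [Tm.shift, Tm.ren_ren, hren] using ihe l (h₂.branch L S l)
  | close d ih =>
    intro Δ Γ' r h
    have hd := ih h
    simp only [tm, Tm.ren, Ty.ren, ty] at hd ⊢
    exact typing_close h hd
  | wait d ih =>
    intro Δ Γ' r h
    have hd := ih h
    simp only [tm, Tm.ren, ty] at hd ⊢
    exact typing_wait h hd

theorem proc_typing {Γ : LSST.Env} {P : LSST.Proc} (d : LSST.ProcTyping Γ P) :
    ∀ {Δ Γ' : Env}, Realizes Δ id Γ Γ' → ProcTyping Γ' (proc d) := by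
  induction d with
  | expr d =>
    intro Δ Γ' h
    have hd := tm_typing d h
    rw [Tm.ren_id] at hd
    simp only [ty, proc] at hd ⊢
    exact .expr hd
  | par hs d e ihd ihe =>
    intro Δ Γ' h
    obtain ⟨Γ₁', Γ₂', hs', h₁, h₂⟩ := h.split hs
    exact .par hs' (ihd h₁) (ihe h₂)
  | nu S d ih =>
    intro Δ Γ' h
    -- Process constructors bind the same names in both calculi, so the renaming stays the identity.
    have hd := ih (upRen_id ▸ (upRen_id ▸ h.bind (.ses S)).bind (.ses S.dual))
    refine .nu h.unr (ses_isSes S) (ses_hasKind S Δ h.unrestricted) ?_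
    simpa only [ty, ← ses_dual, ses_shift] using hd

end Embed

theorem mainTheorem8 :
    (∀ (Γ : LSST.Env) (M : LSST.Tm) (A : LSST.Ty) (d : LSST.Typing Γ M A),
      LDGV.EnvForm .lin (Embed.env Γ) ∧
        LDGV.Typing (Embed.env Γ) (Embed.tm d) (Embed.ty A)) ∧
    (∀ (Γ : LSST.Env) (P : LSST.Proc) (d : LSST.ProcTyping Γ P),
      LDGV.ProcTyping (Embed.env Γ) (Embed.proc d)) := by
  refine ⟨fun Γ M A d => ?_, fun Γ P d => ?_⟩
  · obtain ⟨Δ, h⟩ := Embed.Realizes.id_env Γ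
    have hd := Embed.tm_typing d h
    rw [LDGV.Tm.ren_id] at hd
    exact ⟨h.form (LSST.Env.form_lin Γ), hd⟩
  · obtain ⟨Δ, h⟩ := Embed.Realizes.id_env Γ
    exact Embed.proc_typing d h
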